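/- Let $(X,\mathcal B,\mu)$ be a standard (non-atomic) Lebesgue probability space and let $\mathrm{Aut}$ be the group of its invertible measure-preserving transformations, transformations that differ on a set of measure $0$ being identified. Let $\{A_i\}_{i\ge 1}$ be a sequence of measurable sets that is dense in $\mathcal B$ with respect to the distance $\mu(A\Delta B)$, and equip $\mathrm{Aut}$ with the Halmos metric $$\rho(S,T)=\sum_{i\ge 1}2^{-i}\bigl(\mu(SA_i\Delta TA_i)+\mu(S^{-1}A_i\Delta T^{-1}A_i)\bigr).$$ For a finite measurable partition $\xi=\{C_1,\dots,C_n\}$ put $H(\xi)=-\sum_k\mu(C_k)\ln\mu(C_k)$, and let $$h(T)=\sup_\xi\limsup_{j\to\infty}\frac1{j+1}H\Bigl(\bigvee_{p=0}^{j}T^p\xi\Bigr)$$ be the entropy of $T\in\mathrm{Aut}$. A subset of $\mathrm{Aut}$ is called typical if its complement is of the first category, i.e. a countable union of nowhere dense sets, in $(\mathrm{Aut},\rho)$. **Theorem 7.2.** If $K\subset\{T\in\mathrm{Aut}: h(T)=0\}$ is compact in $(\mathrm{Aut},\rho)$, then the set $$K^{\mathrm{Aut}}=\{J^{-1}SJ:\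 S\in K,\ J\in\mathrm{Aut}\}$$ is of the first category, and it is not typical. -/

import Mathlib

namespace ErgodicAut

open MeasureTheory Filter Set
open scoped symmDiff

variable {X : Type*} [MeasurableSpace X]

/-- Invertible bimeasurable maps `X → X` preserving `μ`, as a group under composition. -/
def mpGroup (μ : Measure X) : Subgroup (Equiv.Perm X) where
  carrier := {e | MeasurePreserving e μ μ ∧ MeasurePreserving e.symm μ μ}
  mul_mem' ha hb := ⟨ha.1.comp hb.1, hb.2.comp ha.2⟩
  one_mem' := ⟨MeasurePreserving.id μ, MeasurePreserving.id μ⟩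
  inv_mem' ha := ⟨ha.2, ha.1⟩

variable {μ : Measure X}

theorem mpGroup_mp (S : mpGroup μ) : MeasurePreserving (S : Equiv.Perm X) μ μ := S.2.1

theorem mpGroup_mp_inv (S : mpGroup μ) :
    MeasurePreserving ((S⁻¹ : mpGroup μ) : Equiv.Perm X) μ μ := S.2.2

/-- The transformations that coincide with the identity outside a null set. -/
def nullGroup (μ : Measure X) : Subgroup (mpGroup μ) where
  carrier := {e | ∀ᵐ x ∂μ, (e : Equiv.Perm X) x = x}
  mul_mem' {a b} ha hb := by
    have h := (mpGroup_mp b).quasiMeasurePreserving.ae ha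
    change ∀ᵐ x ∂μ, _
    filter_upwards [h, hb] with x h1 h2
    exact h1.trans h2
  one_mem' := by simp
  inv_mem' {a} ha := by
    have h := (mpGroup_mp_inv a).quasiMeasurePreserving.ae ha
    change ∀ᵐ x ∂μ, _
    filter_upwards [h] with x h1
    simpa using h1.symm

instance nullGroup_normal (μ : Measure X) : (nullGroup μ).Normal where
  conj_mem n hn g := by
    have h := (mpGroup_mp_inv g).quasiMeasurePreserving.ae hn
    change ∀ᵐ x ∂μ, _
    filter_upwards [h] with x h1
    simp only [Subgroup.coe_mul, Equiv.Perm.coe_mul, Function.comp_apply, h1]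
    simp

/-- The group of automorphisms of the measure space `(X, μ)`: invertible measure-preserving
transformations, those that differ on a null set being identified. -/
abbrev Aut (μ : Measure X) : Type _ := mpGroup μ ⧸ nullGroup μ

/-- Two transformations define the same automorphism iff they agree almost everywhere. -/
theorem mk_eq_mk_iff (S T : mpGroup μ) :
    ((S : Aut μ) = (T : Aut μ)) ↔
      ∀ᵐ x ∂μ, (S : Equiv.Perm X) x = (T : Equiv.Perm X) x := by
  rw [QuotientGroup.eq]
  change (∀ᵐ x ∂μ, ((S⁻¹ * T : mpGroup μ) : Equiv.Perm X) x = x) ↔ _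
  refine eventually_congr (Eventually.of_forall fun x => ?_)
  simp only [Subgroup.coe_mul, Subgroup.coe_inv, Equiv.Perm.coe_mul, Function.comp_apply]
  rw [Equiv.Perm.inv_eq_iff_eq]
  exact eq_comm

theorem inv_ae_eq {S T : mpGroup μ} (h : (S : Aut μ) = (T : Aut μ)) :
    ∀ᵐ x ∂μ, ((S⁻¹ : mpGroup μ) : Equiv.Perm X) x = ((T⁻¹ : mpGroup μ) : Equiv.Perm X) x := by
  rw [← mk_eq_mk_iff, QuotientGroup.mk_inv, QuotientGroup.mk_inv, h]

theorem image_ae_eq {S T : mpGroup μ} (h : (S : Aut μ) = (T : Aut μ)) (B : Set X) :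
    ((S : Equiv.Perm X) '' B : Set X) =ᵐ[μ] ((T : Equiv.Perm X) '' B : Set X) := by
  rw [Equiv.image_eq_preimage_symm, Equiv.image_eq_preimage_symm]
  filter_upwards [inv_ae_eq h] with x hx
  exact congrArg (· ∈ B) hx

/-- `μ(SB ∆ TB)` for automorphisms `S`, `T` and a set `B`. -/
noncomputable def moveDist (B : Set X) (S T : Aut μ) : ℝ :=
  Quotient.liftOn₂' S T
    (fun S T => μ.real (((S : Equiv.Perm X) '' B) ∆ ((T : Equiv.Perm X) '' B)))
    (fun S₁ T₁ S₂ T₂ hS hT => by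
      have h1 := image_ae_eq (Quotient.sound' hS : (S₁ : Aut μ) = S₂) B
      have h2 := image_ae_eq (Quotient.sound' hT : (T₁ : Aut μ) = T₂) B
      exact measureReal_congr (h1.symmDiff h2))

theorem moveDist_mk (B : Set X) (S T : mpGroup μ) :
    moveDist B (S : Aut μ) (T : Aut μ) =
      μ.real (((S : Equiv.Perm X) '' B) ∆ ((T : Equiv.Perm X) '' B)) := rfl

theorem moveDist_nonneg (B : Set X) (S T : Aut μ) : 0 ≤ moveDist B S T := by
  induction S using QuotientGroup.induction_on
  induction T using QuotientGroup.induction_on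
  exact measureReal_nonneg

theorem moveDist_le_one [IsProbabilityMeasure μ] (B : Set X) (S T : Aut μ) :
    moveDist B S T ≤ 1 := by
  induction S using QuotientGroup.induction_on
  induction T using QuotientGroup.induction_on
  exact measureReal_le_one

theorem moveDist_self (B : Set X) (S : Aut μ) : moveDist B S S = 0 := by
  induction S using QuotientGroup.induction_on
  simp [moveDist_mk]

theorem moveDist_comm (B : Set X) (S T : Aut μ) : moveDist B S T = moveDist B T S := by
  induction S using QuotientGroup.induction_on
  induction T using QuotientGroup.induction_on
  rw [moveDist_mk, moveDist_mk, symmDiff_comm]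

theorem moveDist_triangle [IsProbabilityMeasure μ] (B : Set X) (S T U : Aut μ) :
    moveDist B S U ≤ moveDist B S T + moveDist B T U := by
  induction S using QuotientGroup.induction_on
  induction T using QuotientGroup.induction_on
  induction U using QuotientGroup.induction_on
  exact measureReal_symmDiff_le _

/-- The Halmos distance `ρ(S,T) = ∑_{i ≥ 1} 2^{-i} (μ(SAᵢ ∆ TAᵢ) + μ(S⁻¹Aᵢ ∆ T⁻¹Aᵢ))` of a sequence
of measurable sets; the sequence is indexed from `0` here. -/
noncomputable def halmosDist (A : ℕ → MeasuredSets μ) (S T : Aut μ) : ℝ :=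
  ∑' i : ℕ, (1 / 2 : ℝ) ^ (i + 1) * (moveDist (A i : Set X) S T + moveDist (A i : Set X) S⁻¹ T⁻¹)

theorem halmos_summable [IsProbabilityMeasure μ] (A : ℕ → MeasuredSets μ) (S T : Aut μ) :
    Summable fun i : ℕ => (1 / 2 : ℝ) ^ (i + 1) *
      (moveDist (A i : Set X) S T + moveDist (A i : Set X) S⁻¹ T⁻¹) := by
  refine Summable.of_nonneg_of_le (f := fun i : ℕ => (1 / 2 : ℝ) ^ i) (fun i => ?_) (fun i => ?_)
    (summable_geometric_of_lt_one (by norm_num) (by norm_num))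
  · have := moveDist_nonneg (A i : Set X) S T
    have := moveDist_nonneg (A i : Set X) S⁻¹ T⁻¹
    positivity
  · have h1 := moveDist_le_one (A i : Set X) S T
    have h2 := moveDist_le_one (A i : Set X) S⁻¹ T⁻¹
    calc (1 / 2 : ℝ) ^ (i + 1) *
          (moveDist (A i : Set X) S T + moveDist (A i : Set X) S⁻¹ T⁻¹)
        ≤ (1 / 2 : ℝ) ^ (i + 1) * 2 := by gcongr; linarith
      _ = (1 / 2 : ℝ) ^ i := by ring

theorem eq_of_halmosDist_eq_zero [StandardBorelSpace X] [IsProbabilityMeasure μ]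
    (A : ℕ → MeasuredSets μ) (hA : DenseRange A) {S T : Aut μ} (h : halmosDist A S T = 0) :
    S = T := by
  have hnn : ∀ i : ℕ, 0 ≤ (1 / 2 : ℝ) ^ (i + 1) *
      (moveDist (A i : Set X) S T + moveDist (A i : Set X) S⁻¹ T⁻¹) := fun i => by
    have := moveDist_nonneg (A i : Set X) S T
    have := moveDist_nonneg (A i : Set X) S⁻¹ T⁻¹
    positivity
  have hs := (halmos_summable A S T).hasSum
  rw [← halmosDist, h] at hs
  have h0 := (hasSum_zero_iff_of_nonneg hnn).1 hs
  have h1 : ∀ i, moveDist (A i : Set X) S⁻¹ T⁻¹ = 0 := fun i => by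
    have h2 := congrFun h0 i
    have h3 := moveDist_nonneg (A i : Set X) S T
    have h4 := moveDist_nonneg (A i : Set X) S⁻¹ T⁻¹
    have h5 : (0 : ℝ) < (1 / 2 : ℝ) ^ (i + 1) := by positivity
    rcases mul_eq_zero.1 h2 with h6 | h6
    · exact absurd h6 h5.ne'
    · linarith
  clear h h0 hnn
  induction S using QuotientGroup.induction_on with | H S => ?_
  induction T using QuotientGroup.induction_on with | H T => ?_
  have key : ∀ (R : mpGroup μ) (B : Set X),
      ((R⁻¹ : mpGroup μ) : Equiv.Perm X) '' B = (R : Equiv.Perm X) ⁻¹' B := fun R B => by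
    rw [Equiv.image_eq_preimage_symm]; rfl
  have h2 : ∀ i, μ.real (((S : Equiv.Perm X) ⁻¹' (A i)) ∆ ((T : Equiv.Perm X) ⁻¹' (A i))) = 0 :=
    fun i => by
      have := h1 i
      rwa [← QuotientGroup.mk_inv, ← QuotientGroup.mk_inv, moveDist_mk, key, key] at this
  rw [mk_eq_mk_iff]
  refine EventuallyEq.of_forall_separating_preimage MeasurableSet fun U hU => ?_
  rw [← measure_symmDiff_eq_zero_iff, ← measureReal_eq_zero_iff]
  refine le_antisymm (le_of_forall_pos_le_add fun ε hε => ?_) measureReal_nonneg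
  obtain ⟨i, hi⟩ := Metric.denseRange_iff.1 hA ⟨U, hU⟩ (ε / 2) (by positivity)
  change μ.real (U ∆ (A i : Set X)) < ε / 2 at hi
  have hm : MeasurableSet (U ∆ (A i : Set X)) := hU.symmDiff (A i).2
  have hpre : ∀ R : mpGroup μ,
      μ.real (((R : Equiv.Perm X) ⁻¹' U) ∆ ((R : Equiv.Perm X) ⁻¹' (A i))) < ε / 2 := fun R => by
    rw [← preimage_symmDiff, (mpGroup_mp R).measureReal_preimage hm.nullMeasurableSet]
    exact hi
  have hS := hpre S
  have hT := hpre T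
  rw [symmDiff_comm] at hT
  have t1 := measureReal_symmDiff_le (μ := μ) (s := (S : Equiv.Perm X) ⁻¹' U)
    (t := (S : Equiv.Perm X) ⁻¹' (A i)) ((T : Equiv.Perm X) ⁻¹' U)
  have t2 := measureReal_symmDiff_le (μ := μ) (s := (S : Equiv.Perm X) ⁻¹' (A i))
    (t := (T : Equiv.Perm X) ⁻¹' (A i)) ((T : Equiv.Perm X) ⁻¹' U)
  have := h2 i
  linarith

/-- The metric space `(Aut, ρ)` of a sequence that is dense in the algebra of measurable sets with
the pseudometric `μ(B ∆ C)`. -/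
noncomputable abbrev halmosMetric [StandardBorelSpace X] [IsProbabilityMeasure μ]
    (A : ℕ → MeasuredSets μ) (hA : DenseRange A) : MetricSpace (Aut μ) where
  dist := halmosDist A
  dist_self S := by simp [halmosDist, moveDist_self]
  dist_comm S T := by
    unfold halmosDist
    congr 1
    funext i
    rw [moveDist_comm _ S T, moveDist_comm _ S⁻¹ T⁻¹]
  dist_triangle S T U := by
    unfold halmosDist
    rw [← (halmos_summable A S T).tsum_add (halmos_summable A T U)]
    refine (halmos_summable A S U).tsum_le_tsum (fun i => ?_)
      ((halmos_summable A S T).add (halmos_summable A T U))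
    rw [← mul_add]
    have h1 := moveDist_triangle (A i : Set X) S T U
    have h2 := moveDist_triangle (A i : Set X) S⁻¹ T⁻¹ U⁻¹
    exact mul_le_mul_of_nonneg_left (by linarith) (by positivity)
  eq_of_dist_eq_zero h := eq_of_halmosDist_eq_zero A hA h

/-- Entropy `H(ξ) = -∑ μ(C) ln μ(C)` of the finite partition `ξ` into the level sets `C` of `f`
(empty level sets contribute `0`). -/
noncomputable def partEntropy (μ : Measure X) {ι : Type*} [Fintype ι] (f : X → ι) : ℝ :=
  ∑ i, Real.negMulLog (μ.real (f ⁻¹' {i}))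

/-- For the partition `ξ` into level sets of `f`, the level sets of `joinLabel T P f` are the cells
of `⋁_{p ∈ P} T^p ξ`, where `T^p ξ = {T^p C : C ∈ ξ}`; note that `x ∈ T^p C` iff `T^{-p} x ∈ C`. -/
def joinLabel (T : mpGroup μ) (P : Finset ℤ) {n : ℕ} (f : X → Fin n) : X → (P → Fin n) :=
  fun x p => f (((T ^ (-(p : ℤ)) : mpGroup μ) : Equiv.Perm X) x)

/-- `H(⋁_{p ∈ P} T^p ξ)`, where `ξ` is the partition into level sets of `f`. -/
noncomputable def joinEntropy (T : Aut μ) (P : Finset ℤ) {n : ℕ} (f : X → Fin n) : ℝ :=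
  Quotient.liftOn' T (fun T => partEntropy μ (joinLabel T P f)) (fun S T h => by
    have h1 : (S : Aut μ) = T := Quotient.sound' h
    have h2 : ∀ p : P, ∀ᵐ x ∂μ, ((S ^ (-(p : ℤ)) : mpGroup μ) : Equiv.Perm X) x =
        ((T ^ (-(p : ℤ)) : mpGroup μ) : Equiv.Perm X) x := fun p => by
      rw [← mk_eq_mk_iff, QuotientGroup.mk_zpow, QuotientGroup.mk_zpow, h1]
    have h3 : ∀ᵐ x ∂μ, joinLabel S P f x = joinLabel T P f x := by
      filter_upwards [ae_all_iff.2 h2] with x hx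
      funext p
      exact congrArg f (hx p)
    refine Finset.sum_congr rfl fun i _ => congrArg Real.negMulLog (measureReal_congr ?_)
    filter_upwards [h3] with x hx
    exact congrArg (· ∈ ({i} : Set (P → Fin n))) hx)

/-- `h_P(T) = sup_ξ limsup_j |P_j|⁻¹ H(⋁_{p ∈ P_j} T^p ξ)`, the supremum being over all finite
measurable partitions `ξ`, given as level sets of measurable functions `X → {0, …, n - 1}`. -/
noncomputable def pEntropy (P : ℕ → Finset ℤ) (T : Aut μ) : EReal :=
  ⨆ (n : ℕ) (f : {f : X → Fin n // Measurable f}),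
    limsup (fun j : ℕ => ((joinEntropy T (P j) f.1 / ((P j).card : ℝ) : ℝ) : EReal)) atTop

/-- The Kolmogorov–Sinai entropy `h(T)`, i.e. `h_P(T)` for `P_j = {0, 1, …, j}`. -/
noncomputable def entropy (T : Aut μ) : EReal :=
  pEntropy (fun j : ℕ => Finset.Icc (0 : ℤ) j) T

/-- The class `E₀` of automorphisms of zero entropy. -/
def zeroEntropy (μ : Measure X) : Set (Aut μ) := {T | entropy T = 0}

/-- `K^Aut = {J⁻¹ S J : S ∈ K, J ∈ Aut}`. -/
def conjugates (K : Set (Aut μ)) : Set (Aut μ) :=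
  {T | ∃ S ∈ K, ∃ J : Aut μ, T = J⁻¹ * S * J}

/-- A set is typical if its complement is of the first category. -/
def IsTypical {Y : Type*} [TopologicalSpace Y] (s : Set Y) : Prop := IsMeagre sᶜ

end ErgodicAut

/-!
Let `K` be a compact set of automorphisms of zero entropy. The entropy of the join of the
`S ^ (k j)`-translates, `k < L`, of a fixed finite partition is continuous in `S` and `o(L)` for
`S ∈ K`, so by compactness the smallness is uniform on `K`: there are lengths `L j` such that, for
each `A i`, the joins over `{(j + 1) k : k < L j}` have entropy `o(L j)` uniformly on `K`.
Conjugating by `J` replaces a set `B` by `J B`, which some `A i` approximates; hence every conjugate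
of an element of `K` satisfies the same bound for *every* measurable set `B`.

Such automorphisms are rare. Given `T₀`, consider the stationary process that follows `T₀` and, with
small probability at each step, restarts at an independent random point; forgetting everything
older than `N` steps changes it only slightly. As a factor of a Bernoulli shift it is realised on
`X` by some `T` close to `T₀`, and its values at times more than `N` apart are independent. So, for
a set `B` of measure `1/2`, the join over `{(j + 1) k : k < L j}` has entropy `L j * log 2` for all
large `j`. This makes the automorphisms with entropy above `L j * (log 2) / 2` for infinitely many
`j` a dense `Gδ`, which no conjugate of an element of `K` belongs to. Finally, the Halmos metric is
complete, so by Baire's theorem a meagre set is not residual.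
-/

namespace ErgodicAut

open MeasureTheory Filter Set ProbabilityTheory
open scoped symmDiff Topology

section Entropy

theorem negMulLog_sum_le {ι : Type*} {s : Finset ι} {p : ι → ℝ} (hp : ∀ i ∈ s, 0 ≤ p i) :
    Real.negMulLog (∑ i ∈ s, p i) ≤ ∑ i ∈ s, Real.negMulLog (p i) := by
  simp only [Real.negMulLog]
  rw [neg_mul, Finset.sum_mul, ← Finset.sum_neg_distrib]
  refine Finset.sum_le_sum fun i hi => ?_
  rw [neg_mul, neg_le_neg_iff]
  rcases (hp i hi).eq_or_lt with h | h
  · simp [← h]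
  · exact mul_le_mul_of_nonneg_left (Real.log_le_log h (Finset.single_le_sum hp hi)) h.le

theorem sub_mul_le_mul_log {p a b : ℝ} (hp : 0 ≤ p) (ha : p ≤ a) (hb : p ≤ b) :
    p - a * b ≤ p * Real.log p - p * Real.log a - p * Real.log b := by
  rcases hp.eq_or_lt with rfl | h
  · simpa using mul_nonneg ha hb
  · have ha' := h.trans_le ha
    have hb' := h.trans_le hb
    have hlog := Real.log_le_sub_one_of_pos (div_pos (mul_pos ha' hb') h)
    rw [Real.log_div (mul_pos ha' hb').ne' h.ne', Real.log_mul ha'.ne' hb'.ne'] at hlog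
    have hmul := mul_le_mul_of_nonneg_left hlog h.le
    have hdiv : p * (a * b / p - 1) = a * b - p := by field_simp
    linarith

theorem sum_negMulLog_le_marginals {ι κ : Type*} [Fintype ι] [Fintype κ] {p : ι → κ → ℝ}
    (hp : ∀ i j, 0 ≤ p i j) (hone : ∑ i, ∑ j, p i j = 1) :
    ∑ i, ∑ j, Real.negMulLog (p i j) ≤
      ∑ i, Real.negMulLog (∑ j, p i j) + ∑ j, Real.negMulLog (∑ i, p i j) := by
  set a : ι → ℝ := fun i => ∑ j, p i j
  set b : κ → ℝ := fun j => ∑ i, p i j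
  have hb : ∑ j, b j = 1 := by rw [Finset.sum_comm, hone]
  have hzero : ∑ i, ∑ j, (p i j - a i * b j) = 0 := by
    simp only [Finset.sum_sub_distrib, ← Finset.mul_sum, hb, mul_one, a, sub_self,
      Finset.sum_const_zero]
  have hrow : ∑ i, Real.negMulLog (a i) = ∑ i, ∑ j, -(p i j * Real.log (a i)) := by
    simp only [Finset.sum_neg_distrib, ← Finset.sum_mul, Real.negMulLog, neg_mul, a]
  have hcol : ∑ j, Real.negMulLog (b j) = ∑ i, ∑ j, -(p i j * Real.log (b j)) := by
    rw [Finset.sum_comm]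
    simp only [Finset.sum_neg_distrib, ← Finset.sum_mul, Real.negMulLog, neg_mul, b]
  rw [hrow, hcol, ← sub_nonneg, ← hzero]
  simp only [← Finset.sum_add_distrib, ← Finset.sum_sub_distrib]
  refine Finset.sum_le_sum fun i _ => Finset.sum_le_sum fun j _ => ?_
  have hpa : p i j ≤ a i := Finset.single_le_sum (fun k _ => hp i k) (Finset.mem_univ j)
  have hpb : p i j ≤ b j :=
    Finset.single_le_sum (f := fun k => p k j) (fun k _ => hp k j) (Finset.mem_univ i)
  have := sub_mul_le_mul_log (hp i j) hpa hpb
  rw [Real.negMulLog]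
  linarith

variable {Ω : Type*} [MeasurableSpace Ω] {P : Measure Ω}
variable {ι κ τ α : Type*}

theorem partEntropy_const [IsProbabilityMeasure P] [Fintype ι] (i : ι) :
    partEntropy P (fun _ : Ω => i) = 0 := by
  classical
  refine Finset.sum_eq_zero fun j _ => ?_
  by_cases h : i = j <;> simp [h]

theorem partEntropy_congr [Fintype ι] {f g : Ω → ι} (h : f =ᵐ[P] g) :
    partEntropy P f = partEntropy P g := by
  refine Finset.sum_congr rfl fun i _ => congrArg Real.negMulLog (measureReal_congr ?_)
  filter_upwards [h] with x hx
  exact congrArg (· ∈ ({i} : Set ι)) hx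

theorem partEntropy_prodMk [Fintype ι] [Fintype κ] (f : Ω → ι) (g : Ω → κ) :
    partEntropy P (fun x => (f x, g x)) =
      ∑ i, ∑ j, Real.negMulLog (P.real (f ⁻¹' {i} ∩ g ⁻¹' {j})) := by
  simp only [partEntropy, Fintype.sum_prod_type, ← singleton_prod_singleton, mk_preimage_prod]

variable [Fintype ι] [MeasurableSpace ι] [MeasurableSingletonClass ι]

theorem partEntropy_comp_measurePreserving {Ω' : Type*} [MeasurableSpace Ω'] {P' : Measure Ω'}
    {φ : Ω' → Ω} (hφ : MeasurePreserving φ P' P) {f : Ω → ι} (hf : Measurable f) :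
    partEntropy P' (fun x => f (φ x)) = partEntropy P f :=
  Finset.sum_congr rfl fun i _ => congrArg Real.negMulLog <|
    hφ.measureReal_preimage (hf (measurableSet_singleton i)).nullMeasurableSet

theorem measureReal_preimage_comp_singleton [IsFiniteMeasure P] [DecidableEq κ] {f : Ω → ι}
    (hf : Measurable f) (φ : ι → κ) (k : κ) :
    P.real ((fun x => φ (f x)) ⁻¹' {k}) = ∑ i with φ i = k, P.real (f ⁻¹' {i}) := by
  rw [sum_measureReal_preimage_singleton _ fun i _ => hf (measurableSet_singleton i)]
  congr 1
  ext x
  simp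

theorem partEntropy_comp_le [Fintype κ] [IsFiniteMeasure P] {f : Ω → ι} (hf : Measurable f)
    (φ : ι → κ) : partEntropy P (fun x => φ (f x)) ≤ partEntropy P f := by
  classical
  rw [partEntropy, partEntropy, ← Finset.sum_fiberwise Finset.univ φ]
  refine Finset.sum_le_sum fun k _ => ?_
  rw [measureReal_preimage_comp_singleton hf]
  exact negMulLog_sum_le fun _ _ => measureReal_nonneg

theorem sum_measureReal_inter_preimage_singleton [IsFiniteMeasure P] {f : Ω → ι}
    (hf : Measurable f) (s : Set Ω) : ∑ i, P.real (s ∩ f ⁻¹' {i}) = P.real s := by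
  have hmeas := fun i => hf (measurableSet_singleton i)
  have h := sum_measureReal_preimage_singleton (μ := P.restrict s) Finset.univ fun i _ => hmeas i
  simpa [measureReal_restrict_apply (hmeas _), inter_comm] using h

theorem sum_measureReal_preimage_singleton_univ [IsProbabilityMeasure P] {f : Ω → ι}
    (hf : Measurable f) : ∑ i, P.real (f ⁻¹' {i}) = 1 := by
  simpa using sum_measureReal_inter_preimage_singleton (P := P) hf univ

theorem partEntropy_fin_two [IsProbabilityMeasure P] {f : Ω → Fin 2} (hf : Measurable f) :
    partEntropy P f = Real.binEntropy (P.real (f ⁻¹' {1})) := by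
  have h := sum_measureReal_preimage_singleton_univ (P := P) hf
  rw [Fin.sum_univ_two] at h
  rw [partEntropy, Fin.sum_univ_two, Real.binEntropy_eq_negMulLog_add_negMulLog_one_sub,
    ← eq_sub_of_add_eq h, add_comm]

variable [Fintype κ] [MeasurableSpace κ] [MeasurableSingletonClass κ] [IsProbabilityMeasure P]

theorem partEntropy_prodMk_le {f : Ω → ι} {g : Ω → κ} (hf : Measurable f) (hg : Measurable g) :
    partEntropy P (fun x => (f x, g x)) ≤ partEntropy P f + partEntropy P g := by
  have hrow := fun i => sum_measureReal_inter_preimage_singleton (P := P) hg (f ⁻¹' {i})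
  have hcol : ∀ j, ∑ i, P.real (f ⁻¹' {i} ∩ g ⁻¹' {j}) = P.real (g ⁻¹' {j}) := fun j => by
    simp only [inter_comm _ (g ⁻¹' {j}), sum_measureReal_inter_preimage_singleton hf]
  have h := sum_negMulLog_le_marginals (p := fun i j => P.real (f ⁻¹' {i} ∩ g ⁻¹' {j}))
    (fun _ _ => measureReal_nonneg)
    (by simp only [hrow, sum_measureReal_preimage_singleton_univ hf])
  simp only [hrow, hcol] at h
  rwa [partEntropy_prodMk]

theorem partEntropy_prodMk_of_indepFun {f : Ω → ι} {g : Ω → κ} (hf : Measurable f)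
    (hg : Measurable g) (h : IndepFun f g P) :
    partEntropy P (fun x => (f x, g x)) = partEntropy P f + partEntropy P g := by
  have hmul : ∀ i j, P.real (f ⁻¹' {i} ∩ g ⁻¹' {j}) = P.real (f ⁻¹' {i}) * P.real (g ⁻¹' {j}) :=
    fun i j => by
      simpa only [measureReal_def, ENNReal.toReal_mul] using
        congrArg ENNReal.toReal (h.measure_inter_preimage_eq_mul _ _ (measurableSet_singleton i)
          (measurableSet_singleton j))
  rw [partEntropy_prodMk]
  simp only [hmul, Real.negMulLog_mul, Finset.sum_add_distrib, ← Finset.mul_sum, ← Finset.sum_mul,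
    sum_measureReal_preimage_singleton_univ hg, sum_measureReal_preimage_singleton_univ hf,
    one_mul, partEntropy]

end Entropy

section FamEntropy

variable {Ω : Type*} [MeasurableSpace Ω] {P : Measure Ω}
variable {ι κ τ α : Type*} [DecidableEq α] [Fintype ι]

/-- The entropy of the join of the finitely many partitions into level sets of `F p`, `p ∈ s`. -/
noncomputable def famEntropy (P : Measure Ω) (F : α → Ω → ι) (s : Finset α) : ℝ :=
  partEntropy P (fun x (p : s) => F p x)

variable [IsProbabilityMeasure P] {F : α → Ω → ι}

theorem famEntropy_empty : famEntropy P F ∅ = 0 := by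
  rw [famEntropy, Subsingleton.elim (fun x (p : (∅ : Finset α)) => F p x) fun _ => isEmptyElim]
  exact partEntropy_const _

variable [MeasurableSpace ι] [MeasurableSingletonClass ι]

omit [DecidableEq α] [Fintype ι] [MeasurableSingletonClass ι] in
theorem measurable_restrict_fam (hF : ∀ p, Measurable (F p)) (s : Finset α) :
    Measurable (fun x (p : s) => F p x) :=
  measurable_pi_lambda _ fun p => hF p

theorem famEntropy_mono (hF : ∀ p, Measurable (F p)) {s t : Finset α} (h : s ⊆ t) :
    famEntropy P F s ≤ famEntropy P F t :=
  partEntropy_comp_le (measurable_restrict_fam hF t) fun (c : t → ι) (p : s) => c ⟨p, h p.2⟩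

theorem famEntropy_image_le {β : Type*} [DecidableEq β] (hF : ∀ p, Measurable (F p)) (g : β → α)
    (s : Finset β) : famEntropy P F (s.image g) ≤ famEntropy P (fun b => F (g b)) s := by
  choose b hbs hb using fun q : s.image g => Finset.mem_image.1 q.2
  refine le_of_eq_of_le ?_ (partEntropy_comp_le (measurable_restrict_fam (fun b => hF (g b)) s)
    fun (c : s → ι) (q : s.image g) => c ⟨b q, hbs q⟩)
  simp only [famEntropy, hb]

theorem famEntropy_union_le (hF : ∀ p, Measurable (F p)) (s t : Finset α) :
    famEntropy P F (s ∪ t) ≤ famEntropy P F s + famEntropy P F t := by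
  refine le_trans (le_of_eq_of_le ?_ (partEntropy_comp_le
    ((measurable_restrict_fam hF s).prodMk (measurable_restrict_fam hF t))
    (fun (c : (s → ι) × (t → ι)) (p : (s ∪ t : Finset α)) =>
      if h : (p : α) ∈ s then c.1 ⟨p, h⟩ else
        c.2 ⟨p, (Finset.mem_union.1 p.2).resolve_left h⟩)))
    (partEntropy_prodMk_le (measurable_restrict_fam hF s) (measurable_restrict_fam hF t))
  rw [famEntropy]
  congr 1
  funext x p
  by_cases h : (p : α) ∈ s <;> simp [h]

theorem famEntropy_singleton_le (hF : ∀ p, Measurable (F p)) (a : α) :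
    famEntropy P F {a} ≤ partEntropy P (F a) := by
  refine le_of_eq_of_le ?_ (partEntropy_comp_le (hF a) fun i (_ : ({a} : Finset α)) => i)
  rw [famEntropy]
  congr 1
  funext x p
  rw [Finset.mem_singleton.1 p.2]

theorem famEntropy_le_sum (hF : ∀ p, Measurable (F p)) (s : Finset α) :
    famEntropy P F s ≤ ∑ p ∈ s, partEntropy P (F p) := by
  induction s using Finset.induction_on with
  | empty => simp [famEntropy_empty]
  | insert a s ha ih =>
    rw [Finset.sum_insert ha, Finset.insert_eq]
    exact (famEntropy_union_le hF _ _).trans (add_le_add (famEntropy_singleton_le hF a) ih)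

theorem add_famEntropy_le_famEntropy_insert (hF : ∀ p, Measurable (F p)) {a : α}
    {s : Finset α} (h : IndepFun (F a) (fun x (p : s) => F p x) P) :
    partEntropy P (F a) + famEntropy P F s ≤ famEntropy P F (insert a s) := by
  rw [famEntropy, famEntropy,
    ← partEntropy_prodMk_of_indepFun (hF a) (measurable_restrict_fam hF s) h]
  exact partEntropy_comp_le (measurable_restrict_fam hF (insert a s))
    fun (c : ↥(insert a s) → ι) =>
      (c ⟨a, Finset.mem_insert_self a s⟩, fun p : s => c ⟨p, Finset.mem_insert_of_mem p.2⟩)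

omit [MeasurableSpace ι] [MeasurableSingletonClass ι] in
theorem famEntropy_le_add_sum [Fintype κ] [MeasurableSpace κ] [MeasurableSingletonClass κ]
    [Fintype τ] [MeasurableSpace τ] [MeasurableSingletonClass τ] {G : α → Ω → κ} {D : α → Ω → τ}
    (hG : ∀ p, Measurable (G p)) (hD : ∀ p, Measurable (D p)) (c : κ → τ → ι)
    (hc : ∀ p x, F p x = c (G p x) (D p x)) (s : Finset α) :
    famEntropy P F s ≤ famEntropy P G s + ∑ p ∈ s, partEntropy P (D p) := by
  have hpair : famEntropy P F s ≤
      partEntropy P (fun x => ((fun p : s => G p x), fun p : s => D p x)) := by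
    refine le_of_eq_of_le ?_ (partEntropy_comp_le
      ((measurable_restrict_fam hG s).prodMk (measurable_restrict_fam hD s))
      (fun (b : (s → κ) × (s → τ)) (p : s) => c (b.1 p) (b.2 p)))
    simp only [famEntropy, hc]
  calc famEntropy P F s
      ≤ famEntropy P G s + famEntropy P D s := hpair.trans
        (partEntropy_prodMk_le (measurable_restrict_fam hG s) (measurable_restrict_fam hD s))
    _ ≤ _ := by gcongr; exact famEntropy_le_sum hD s

end FamEntropy

section AEIso

/-- The measurable maps `f` and `g` are measure preserving and inverse to each other almost
everywhere, i.e. they form an isomorphism mod `0` of measure spaces. -/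
structure AEIso {Ω Ω' : Type*} [MeasurableSpace Ω] [MeasurableSpace Ω'] (P : Measure Ω)
    (P' : Measure Ω') (f : Ω → Ω') (g : Ω' → Ω) : Prop where
  mp : MeasurePreserving f P P'
  mp_inv : MeasurePreserving g P' P
  left_inv : ∀ᵐ x ∂P, g (f x) = x
  right_inv : ∀ᵐ y ∂P', f (g y) = y

variable {Ω Ω' Ω'' : Type*} [MeasurableSpace Ω] [MeasurableSpace Ω'] [MeasurableSpace Ω'']
  {P : Measure Ω} {P' : Measure Ω'} {P'' : Measure Ω''}

theorem AEIso.symm {f : Ω → Ω'} {g : Ω' → Ω} (h : AEIso P P' f g) : AEIso P' P g f :=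
  ⟨h.mp_inv, h.mp, h.right_inv, h.left_inv⟩

theorem AEIso.trans {f : Ω → Ω'} {g : Ω' → Ω} {f' : Ω' → Ω''} {g' : Ω'' → Ω'}
    (h : AEIso P P' f g) (h' : AEIso P' P'' f' g') :
    AEIso P P'' (fun x => f' (f x)) (fun x => g (g' x)) := by
  refine ⟨h'.mp.comp h.mp, h.mp_inv.comp h'.mp_inv, ?_, ?_⟩
  · filter_upwards [h.mp.quasiMeasurePreserving.ae h'.left_inv, h.left_inv] with x h1 h2
    rw [h1, h2]
  · filter_upwards [h'.mp_inv.quasiMeasurePreserving.ae h.right_inv, h'.right_inv] with x h1 h2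
    rw [h1, h2]

theorem AEIso.of_left_inv [MeasurableEq Ω'] {f : Ω → Ω'} {g : Ω' → Ω}
    (hf : MeasurePreserving f P P') (hg : Measurable g)
    (h : ∀ᵐ x ∂P, g (f x) = x) : AEIso P P' f g := by
  have hmap : Measure.map g P' = P := by
    rw [← hf.map_eq, Measure.map_map hg hf.measurable]
    exact (Measure.map_congr h).trans Measure.map_id
  refine ⟨hf, ⟨hg, hmap⟩, h, ?_⟩
  rw [← hf.map_eq]
  refine (ae_map_iff hf.measurable.aemeasurable
    (measurableSet_eq_fun (hf.measurable.comp hg) measurable_id)).2 ?_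
  filter_upwards [h] with x hx
  exact congrArg f hx

theorem uncountable_of_nullSingletonClass (P : Measure Ω) [NeZero P] [NullSingletonClass P] :
    Uncountable Ω := by
  by_contra h
  rw [not_uncountable_iff] at h
  exact NeZero.ne P (Measure.measure_univ_eq_zero.1 (countable_univ.measure_zero P))

theorem exists_not_countable_measure_eq_zero [StandardBorelSpace Ω] [Uncountable Ω]
    (P : Measure Ω) [SFinite P] :
    ∃ N : Set Ω, MeasurableSet N ∧ P N = 0 ∧ ¬ N.Countable := by
  let e : Ω ≃ᵐ ℝ × ℝ := PolishSpace.measurableEquivOfNotCountable not_countable not_countable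
  have hfst : Measurable fun x => (e x).1 := measurable_fst.comp e.measurable
  -- Only countably many of the uncountably many disjoint vertical lines have positive measure.
  obtain ⟨a, ha⟩ : ∃ a : ℝ, P {x | (e x).1 = a} = 0 := by
    by_contra! h
    refine not_countable_univ (α := ℝ) ?_
    exact (Measure.countable_meas_level_set_pos hfst).mono fun a _ => pos_iff_ne_zero.2 (h a)
  refine ⟨{x | (e x).1 = a}, hfst (measurableSet_singleton a), ha, fun hc => ?_⟩
  have hinj : Function.Injective fun b : ℝ => e.symm (a, b) := fun b c hbc =>
    (Prod.mk.inj (e.symm.injective hbc)).2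
  have hpre : (fun b : ℝ => e.symm (a, b)) ⁻¹' {x | (e x).1 = a} = univ := by
    ext b
    simp
  exact not_countable_univ (hpre ▸ hc.preimage hinj)

theorem exists_measurableEquiv_eqOn [StandardBorelSpace Ω] [StandardBorelSpace Ω'] {f : Ω → Ω'}
    {g : Ω' → Ω} (hf : Measurable f) (hg : Measurable g) {s : Set Ω} {t : Set Ω'}
    (hs : MeasurableSet s) (ht : MeasurableSet t) (hfst : MapsTo f s t) (hgts : MapsTo g t s)
    (hinv : InvOn g f s t) (hsc : ¬ sᶜ.Countable) (htc : ¬ tᶜ.Countable) :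
    ∃ e : Ω ≃ᵐ Ω', EqOn e f s := by
  classical
  let a : s ≃ᵐ t :=
    { toFun := hfst.restrict
      invFun := hgts.restrict
      left_inv := fun x => Subtype.ext (hinv.1 x.2)
      right_inv := fun y => Subtype.ext (hinv.2 y.2)
      measurable_toFun := (hf.comp measurable_subtype_coe).subtype_mk
      measurable_invFun := (hg.comp measurable_subtype_coe).subtype_mk }
  have := hs.compl.standardBorel
  have := ht.compl.standardBorel
  let b : (sᶜ : Set Ω) ≃ᵐ (tᶜ : Set Ω') := PolishSpace.measurableEquivOfNotCountable
    (mt countable_coe_iff.1 hsc) (mt countable_coe_iff.1 htc)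
  refine ⟨(MeasurableEquiv.sumCompl hs).symm.trans
    ((MeasurableEquiv.sumCongr a b).trans (MeasurableEquiv.sumCompl ht)), fun x hx => ?_⟩
  have hinl : (MeasurableEquiv.sumCompl hs).symm x = Sum.inl ⟨x, hx⟩ := by
    rw [MeasurableEquiv.symm_apply_eq]
    rfl
  simp only [MeasurableEquiv.trans_apply, hinl]
  rfl

theorem AEIso.exists_measurableEquiv [StandardBorelSpace Ω] [StandardBorelSpace Ω']
    [Uncountable Ω] [Uncountable Ω'] [SFinite P] [SFinite P'] {f : Ω → Ω'} {g : Ω' → Ω}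
    (h : AEIso P P' f g) : ∃ e : Ω ≃ᵐ Ω', e =ᵐ[P] f := by
  obtain ⟨N, hN, hN0, hNc⟩ := exists_not_countable_measure_eq_zero P
  obtain ⟨N', hN', hN'0, hN'c⟩ := exists_not_countable_measure_eq_zero P'
  have hf := h.mp.measurable
  have hg := h.mp_inv.measurable
  -- Removing uncountable null sets leaves room for a bijection between the complements.
  let s : Set Ω := {x | g (f x) = x} ∩ (Nᶜ ∩ f ⁻¹' N'ᶜ)
  let t : Set Ω' := {y | f (g y) = y} ∩ (N'ᶜ ∩ g ⁻¹' Nᶜ)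
  have hs : MeasurableSet s :=
    (measurableSet_eq_fun (hg.comp hf) measurable_id).inter (hN.compl.inter (hf hN'.compl))
  have ht : MeasurableSet t :=
    (measurableSet_eq_fun (hf.comp hg) measurable_id).inter (hN'.compl.inter (hg hN.compl))
  have hfst : MapsTo f s t := fun x ⟨hx, hxN, hfx⟩ =>
    ⟨congrArg f hx, hfx, by rwa [mem_preimage, show g (f x) = x from hx]⟩
  have hgts : MapsTo g t s := fun y ⟨hy, hyN, hgy⟩ =>
    ⟨congrArg g hy, hgy, by rwa [mem_preimage, show f (g y) = y from hy]⟩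
  obtain ⟨e, he⟩ := exists_measurableEquiv_eqOn hf hg hs ht hfst hgts
    ⟨fun x hx => hx.1, fun y hy => hy.1⟩
    (fun hc => hNc (hc.mono fun x hx (hxs : x ∈ s) => hxs.2.1 hx))
    (fun hc => hN'c (hc.mono fun y hy (hyt : y ∈ t) => hyt.2.1 hy))
  refine ⟨e, ?_⟩
  have hNae : ∀ᵐ x ∂P, x ∉ N := measure_eq_zero_iff_ae_notMem.1 hN0
  have hN'ae : ∀ᵐ y ∂P', y ∉ N' := measure_eq_zero_iff_ae_notMem.1 hN'0
  filter_upwards [h.left_inv, hNae, h.mp.quasiMeasurePreserving.ae hN'ae] with x h1 h2 h3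
  exact he ⟨h1, h2, h3⟩

theorem AEIso.exists_mpGroup [StandardBorelSpace Ω] [Uncountable Ω] [SFinite P] {f g : Ω → Ω}
    (h : AEIso P P f g) : ∃ S : mpGroup P, (S : Equiv.Perm Ω) =ᵐ[P] f := by
  obtain ⟨e, he⟩ := h.exists_measurableEquiv
  have hmp : MeasurePreserving e P P := ⟨e.measurable, (Measure.map_congr he).trans h.mp.map_eq⟩
  exact ⟨⟨e.toEquiv, hmp, hmp.symm e⟩, he⟩

end AEIso

section Quantile

theorem continuous_cdf (P : Measure ℝ) [IsProbabilityMeasure P] [NullSingletonClass P] :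
    Continuous (cdf P) := by
  refine continuous_iff_continuousAt.2 fun x => ?_
  rw [(cdf P).mono.continuousAt_iff_leftLim_eq_rightLim, (cdf P).rightLim_eq]
  refine le_antisymm ((cdf P).mono.leftLim_le le_rfl) ?_
  have h := (cdf P).measure_singleton x
  rw [measure_cdf, measure_singleton, eq_comm, ENNReal.ofReal_eq_zero] at h
  exact sub_nonpos.1 h

/-- The quantile function of a probability on the line, i.e. the generalized inverse of its
distribution function. The infimum is over a nonempty set bounded from below only for
`t ∈ (0, 1)`; the function is extended by `0` to the other `t`. -/
noncomputable def quantile (P : Measure ℝ) : ℝ → ℝ :=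
  (Ioo (0 : ℝ) 1).indicator fun t => sInf {x | t ≤ cdf P x}

theorem quantile_le_iff (P : Measure ℝ) {t : ℝ} (ht : t ∈ Ioo (0 : ℝ) 1) (x : ℝ) :
    quantile P t ≤ x ↔ t ≤ cdf P x := by
  have hne : {x | t ≤ cdf P x}.Nonempty :=
    ((tendsto_cdf_atTop P).eventually_const_le ht.2).exists
  have hbd : BddBelow {x | t ≤ cdf P x} := by
    obtain ⟨a, ha⟩ := ((tendsto_cdf_atBot P).eventually_lt_const ht.1).exists
    exact ⟨a, fun x hx => (monotone_cdf P).reflect_lt (ha.trans_le hx) |>.le⟩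
  rw [quantile, indicator_of_mem ht]
  refine ⟨fun h => ?_, fun h => csInf_le hbd h⟩
  refine ge_of_tendsto (((cdf P).right_continuous x).mono Ioi_subset_Ici_self) ?_
  filter_upwards [self_mem_nhdsWithin] with y hy
  obtain ⟨z, hz, hzy⟩ := (csInf_lt_iff hbd hne).1 (h.trans_lt hy)
  exact le_trans hz (monotone_cdf P hzy.le)

theorem cdf_quantile (P : Measure ℝ) [IsProbabilityMeasure P] [NullSingletonClass P] {t : ℝ}
    (ht : t ∈ Ioo (0 : ℝ) 1) : cdf P (quantile P t) = t := by
  refine le_antisymm ?_ ((quantile_le_iff P ht _).1 le_rfl)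
  obtain ⟨x, hx⟩ : t ∈ range (cdf P) := mem_range_of_exists_le_of_exists_ge (continuous_cdf P)
    ((tendsto_cdf_atBot P).eventually_le_const ht.1).exists
    ((tendsto_cdf_atTop P).eventually_const_le ht.2).exists
  exact (monotone_cdf P ((quantile_le_iff P ht x).2 hx.ge)).trans hx.le

theorem Ioo_inter_preimage_quantile_Iic (P : Measure ℝ) (x : ℝ) :
    Ioo 0 1 ∩ quantile P ⁻¹' Iic x = Ioo 0 1 ∩ Iic (cdf P x) := by
  ext t
  exact and_congr_right fun ht => quantile_le_iff P ht x

theorem measurable_quantile (P : Measure ℝ) : Measurable (quantile P) := by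
  refine measurable_of_Iic fun x => ?_
  have houtside : (Ioo 0 1)ᶜ ∩ quantile P ⁻¹' Iic x = (Ioo 0 1)ᶜ ∩ {_t | 0 ≤ x} := by
    ext t
    refine and_congr_right fun ht => ?_
    rw [mem_preimage, quantile, indicator_of_notMem ht]
    rfl
  rw [← inter_union_compl (quantile P ⁻¹' Iic x) (Ioo 0 1), inter_comm, inter_comm _ (Ioo 0 1)ᶜ,
    Ioo_inter_preimage_quantile_Iic, houtside]
  exact (measurableSet_Ioo.inter measurableSet_Iic).union
    (measurableSet_Ioo.compl.inter (MeasurableSet.const _))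

theorem measurePreserving_quantile (P : Measure ℝ) [IsProbabilityMeasure P] :
    MeasurePreserving (quantile P) (volume.restrict (Ioo (0 : ℝ) 1)) P := by
  refine ⟨measurable_quantile P, (Measure.ext_of_Iic _ _ fun x => ?_).symm⟩
  have hIoc : (Ioo (0 : ℝ) 1 ∩ Iic (cdf P x) : Set ℝ) =ᵐ[volume] Ioc 0 (cdf P x) := by
    filter_upwards [Measure.ae_ne volume (1 : ℝ)] with t ht
    exact propext ⟨fun h => ⟨h.1.1, h.2⟩, fun h =>
      ⟨⟨h.1, lt_of_le_of_ne (h.2.trans (cdf_le_one P x)) ht⟩, h.2⟩⟩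
  rw [Measure.map_apply (measurable_quantile P) measurableSet_Iic,
    Measure.restrict_apply (measurable_quantile P measurableSet_Iic), inter_comm,
    Ioo_inter_preimage_quantile_Iic, measure_congr hIoc, Real.volume_Ioc, sub_zero, ofReal_cdf]

theorem aeIso_quantile_cdf (P : Measure ℝ) [IsProbabilityMeasure P] [NullSingletonClass P] :
    AEIso (volume.restrict (Ioo (0 : ℝ) 1)) P (quantile P) (cdf P) :=
  AEIso.of_left_inv (measurePreserving_quantile P) (continuous_cdf P).measurable <|
    (ae_restrict_iff' measurableSet_Ioo).2 (Eventually.of_forall fun _ ht => cdf_quantile P ht)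

end Quantile

section Isomorphism

variable {Ω : Type*} [MeasurableSpace Ω] [StandardBorelSpace Ω]

/-- A real coordinate on a standard Borel space that takes the cell `{q = i}` into the interval
`(i, i + 1)`. -/
noncomputable def labelCoord (q : Ω → ℕ) (x : Ω) : ℝ :=
  q x + Real.sigmoid (embeddingReal Ω x)

theorem labelCoord_le_natCast_iff (q : Ω → ℕ) (x : Ω) (i : ℕ) : labelCoord q x ≤ i ↔ q x < i := by
  have h0 := Real.sigmoid_pos (embeddingReal Ω x)
  have h1 := Real.sigmoid_lt_one (embeddingReal Ω x)
  rw [labelCoord]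
  refine ⟨fun h => ?_, fun h => ?_⟩
  · exact_mod_cast (by linarith : (q x : ℝ) < i)
  · have : ((q x + 1 : ℕ) : ℝ) ≤ i := by exact_mod_cast h
    push_cast at this
    linarith

theorem measurableEmbedding_labelCoord {q : Ω → ℕ} (hq : Measurable q) :
    MeasurableEmbedding (labelCoord q) := by
  have hemb := measurableEmbedding_embeddingReal Ω
  have hmeas : Measurable (labelCoord q) := (measurable_from_top.comp hq).add
    (continuous_sigmoid.measurable.comp hemb.measurable)
  refine hmeas.measurableEmbedding fun x y hxy => ?_
  have hqxy : q x = q y := eq_of_forall_gt_iff fun i => by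
    rw [← labelCoord_le_natCast_iff, hxy, labelCoord_le_natCast_iff]
  rw [labelCoord, labelCoord, hqxy] at hxy
  exact hemb.injective (Real.sigmoid_injective (add_left_cancel hxy))

variable {P : Measure Ω} [IsProbabilityMeasure P] [NullSingletonClass P]

theorem exists_aeIso_unit {q : Ω → ℕ} (hq : Measurable q) :
    ∃ (g : ℝ → Ω) (f : Ω → ℝ), AEIso (volume.restrict (Ioo (0 : ℝ) 1)) P g f ∧
      ∀ᵐ t ∂(volume.restrict (Ioo (0 : ℝ) 1)), ∀ i : ℕ, q (g t) < i ↔ t ≤ P.real {x | q x < i} := by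
  have : Nonempty Ω := P.nonempty_of_neZero
  have hθ := measurableEmbedding_labelCoord hq
  let Q : Measure ℝ := P.map (labelCoord q)
  have : IsProbabilityMeasure Q := Measure.isProbabilityMeasure_map hθ.measurable.aemeasurable
  have : NullSingletonClass Q := ⟨fun a => by
    rw [hθ.map_apply]
    exact ((countable_singleton a).preimage hθ.injective).measure_zero P⟩
  have hcoord : AEIso P Q (labelCoord q) hθ.invFun :=
    AEIso.of_left_inv (hθ.measurable.measurePreserving P) hθ.measurable_invFun
      (Eventually.of_forall hθ.leftInverse_invFun)
  have hquant := aeIso_quantile_cdf Q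
  have hcdf : ∀ i : ℕ, cdf Q i = P.real {x | q x < i} := fun i => by
    rw [cdf_eq_real, map_measureReal_apply hθ.measurable measurableSet_Iic]
    exact congrArg P.real (Set.ext fun x => labelCoord_le_natCast_iff q x i)
  refine ⟨_, _, hquant.trans hcoord.symm, ?_⟩
  filter_upwards [hquant.mp.quasiMeasurePreserving.ae hcoord.right_inv,
    ae_restrict_mem measurableSet_Ioo] with t hinv ht i
  rw [← labelCoord_le_natCast_iff, hinv, quantile_le_iff Q ht, hcdf]

theorem exists_aeIso_of_measure_preimage_eq {Ω' : Type*} [MeasurableSpace Ω']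
    [StandardBorelSpace Ω'] {P' : Measure Ω'} [IsProbabilityMeasure P'] [NullSingletonClass P']
    {q : Ω → ℕ} {q' : Ω' → ℕ} (hq : Measurable q) (hq' : Measurable q')
    (h : ∀ s : Set ℕ, P (q ⁻¹' s) = P' (q' ⁻¹' s)) :
    ∃ (f : Ω → Ω') (g : Ω' → Ω), AEIso P P' f g ∧ ∀ᵐ x ∂P, q' (f x) = q x := by
  obtain ⟨g₁, f₁, hiso₁, hcells₁⟩ := exists_aeIso_unit (P := P) hq
  obtain ⟨g₂, f₂, hiso₂, hcells₂⟩ := exists_aeIso_unit (P := P') hq'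
  have hreal : ∀ i, P.real {x | q x < i} = P'.real {x | q' x < i} := fun i =>
    congrArg ENNReal.toReal (h (Iio i))
  refine ⟨_, _, hiso₁.symm.trans hiso₂, ?_⟩
  filter_upwards [hiso₁.mp_inv.quasiMeasurePreserving.ae (hcells₁.and hcells₂), hiso₁.right_inv]
    with x hx hinv
  exact eq_of_forall_gt_iff fun i => by rw [hx.2, ← hreal, ← hx.1, hinv]

end Isomorphism

section MeasuredSets

variable {X : Type*} [MeasurableSpace X] {μ : Measure X}

theorem measurableSet_coe (A : MeasuredSets μ) : MeasurableSet (A : Set X) := A.2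

/-- A measurable set as a point of the space of measurable sets with the pseudometric
`μ (B ∆ C)`; the bare pair `⟨B, hB⟩` elaborates in the underlying subtype instead. -/
def measuredSet (μ : Measure X) (B : Set X) (hB : MeasurableSet B) : MeasuredSets μ := ⟨B, hB⟩

theorem notMem_symmDiff_iff {α : Type*} {s t : Set α} {x : α} : x ∉ s ∆ t ↔ (x ∈ s ↔ x ∈ t) := by
  rw [mem_symmDiff]
  tauto

theorem symmDiff_liminf_subset {α : Type*} (u : ℕ → Set α) (n : ℕ) :
    u n ∆ liminf u atTop ⊆ ⋃ k, u (n + k) ∆ u (n + k + 1) := by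
  refine compl_subset_compl.1 fun x hx => notMem_symmDiff_iff.2 ?_
  simp only [mem_compl_iff, mem_iUnion, not_exists, notMem_symmDiff_iff] at hx
  have hn : ∀ k, x ∈ u n ↔ x ∈ u (n + k) := fun k => by
    induction k with
    | zero => rfl
    | succ k ih => exact ih.trans (hx k)
  rw [mem_liminf_iff_eventually_mem, eventually_atTop]
  refine ⟨fun h => ⟨n, fun m hm => ?_⟩, fun ⟨N, hN⟩ => (hn N).2 (hN _ (Nat.le_add_left _ _))⟩
  obtain ⟨k, rfl⟩ := Nat.exists_eq_add_of_le hm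
  exact (hn k).1 h

instance instCompleteSpaceMeasuredSets (μ : Measure X) : CompleteSpace (MeasuredSets μ) := by
  refine EMetric.complete_of_convergent_controlled_sequences (fun n : ℕ => (2⁻¹ : ENNReal) ^ n)
    (fun n => ENNReal.pow_pos (by simp) n) fun u hu => ?_
  let G : MeasuredSets μ := ⟨liminf (fun n => (u n : Set X)) atTop,
    MeasurableSet.measurableSet_liminf fun n => measurableSet_coe (u n)⟩
  have hbound : ∀ n, edist (u n) G ≤ (2⁻¹ : ENNReal) ^ n * 2 := fun n => calc
    edist (u n) G ≤ ∑' k, edist (u (n + k)) (u (n + k + 1)) :=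
      (measure_mono (symmDiff_liminf_subset (fun n => (u n : Set X)) n)).trans (measure_iUnion_le _)
    _ ≤ ∑' k : ℕ, (2⁻¹ : ENNReal) ^ n * 2⁻¹ ^ k := by
      refine ENNReal.tsum_le_tsum fun k => ?_
      rw [← pow_add]
      exact (hu (n + k) (n + k) (n + k + 1) le_rfl (Nat.le_succ _)).le
    _ = (2⁻¹ : ENNReal) ^ n * 2 := by
      rw [ENNReal.tsum_mul_left, ENNReal.tsum_geometric, ENNReal.one_sub_inv_two, inv_inv]
  have hlim : Tendsto (fun n : ℕ => (2⁻¹ : ENNReal) ^ n * 2) atTop (𝓝 (0 * 2)) :=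
    ENNReal.Tendsto.mul_const
      (ENNReal.tendsto_pow_atTop_nhds_zero_of_lt_one (by simp)) (Or.inr (by simp))
  rw [zero_mul] at hlim
  exact ⟨G, tendsto_iff_edist_tendsto_0.2 <|
    tendsto_of_tendsto_of_tendsto_of_le_of_le tendsto_const_nhds hlim (fun _ => zero_le) hbound⟩

theorem abs_measureReal_biInter_sub_le [IsFiniteMeasure μ] {ι : Type*} (F : Finset ι)
    {s t : ι → Set X} (hs : ∀ i, MeasurableSet (s i)) (ht : ∀ i, MeasurableSet (t i)) :
    |μ.real (⋂ i ∈ F, s i) - μ.real (⋂ i ∈ F, t i)| ≤ ∑ i ∈ F, μ.real (s i ∆ t i) := by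
  have hsub : (⋂ i ∈ F, s i) ∆ (⋂ i ∈ F, t i) ⊆ ⋃ i ∈ F, s i ∆ t i := by
    refine compl_subset_compl.1 fun x hx => notMem_symmDiff_iff.2 ?_
    simp only [mem_compl_iff, mem_iUnion, not_exists, notMem_symmDiff_iff] at hx
    simp only [mem_iInter]
    exact forall₂_congr hx
  calc |μ.real (⋂ i ∈ F, s i) - μ.real (⋂ i ∈ F, t i)|
      ≤ μ.real ((⋂ i ∈ F, s i) ∆ (⋂ i ∈ F, t i)) := abs_measureReal_sub_le_measureReal_symmDiff
        (F.measurableSet_biInter fun i _ => hs i).nullMeasurableSet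
        (F.measurableSet_biInter fun i _ => ht i).nullMeasurableSet
    _ ≤ μ.real (⋃ i ∈ F, s i ∆ t i) := measureReal_mono hsub (measure_ne_top μ _)
    _ ≤ ∑ i ∈ F, μ.real (s i ∆ t i) := measureReal_biUnion_finset_le F _

theorem tendsto_measureReal_biInter [IsFiniteMeasure μ] {ι : Type*} (F : Finset ι)
    {s : ℕ → ι → Set X} {t : ι → Set X} (hs : ∀ n i, MeasurableSet (s n i))
    (ht : ∀ i, MeasurableSet (t i))
    (h : ∀ i, Tendsto (fun n => μ.real (s n i ∆ t i)) atTop (𝓝 0)) :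
    Tendsto (fun n => μ.real (⋂ i ∈ F, s n i)) atTop (𝓝 (μ.real (⋂ i ∈ F, t i))) := by
  have hsum : Tendsto (fun n => ∑ i ∈ F, μ.real (s n i ∆ t i)) atTop (𝓝 0) := by
    simpa using tendsto_finsetSum F fun i _ => h i
  exact tendsto_iff_dist_tendsto_zero.2 <| squeeze_zero (fun _ => dist_nonneg)
    (fun n => abs_measureReal_biInter_sub_le F (hs n) ht) hsum

theorem generateFrom_forall_mem_finset (ι : Type*) [Countable ι] :
    MeasurableSpace.generateFrom (range fun F : Finset ι => {c : ι → Prop | ∀ i ∈ F, c i}) =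
      MeasurableSpace.pi := by
  refine le_antisymm (MeasurableSpace.generateFrom_le ?_) (iSup_le fun i => ?_)
  · rintro _ ⟨F, rfl⟩
    exact measurableSet_setOfPred.2 (by fun_prop)
  · refine Measurable.comap_le (@measurable_to_prop _ (_) _ ?_)
    refine MeasurableSpace.measurableSet_generateFrom ⟨{i}, ?_⟩
    ext c
    simp

theorem measurable_mem_seq {ι : Type*} {G : ι → Set X} (hG : ∀ i, MeasurableSet (G i)) :
    Measurable fun x i => x ∈ G i :=
  measurable_pi_lambda _ fun i => measurableSet_setOfPred.1 (hG i)

theorem map_mem_seq_eq [IsFiniteMeasure μ] {ι : Type*} [Countable ι] {A G : ι → Set X}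
    (hA : ∀ i, MeasurableSet (A i)) (hG : ∀ i, MeasurableSet (G i))
    (h : ∀ F : Finset ι, μ.real (⋂ i ∈ F, G i) = μ.real (⋂ i ∈ F, A i)) :
    μ.map (fun x i => x ∈ G i) = μ.map (fun x i => x ∈ A i) := by
  classical
  have hcyl : ∀ {D : ι → Set X}, (∀ i, MeasurableSet (D i)) → ∀ F : Finset ι,
      μ.map (fun x i => x ∈ D i) {c | ∀ i ∈ F, c i} = μ (⋂ i ∈ F, D i) := fun hD F => by
    rw [Measure.map_apply (measurable_mem_seq hD) (measurableSet_setOfPred.2 (by fun_prop))]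
    congr 1
    ext x
    simp
  refine ext_of_generate_finite _ (generateFrom_forall_mem_finset ι).symm ?_ ?_ ?_
  · rintro _ ⟨F, rfl⟩ _ ⟨F', rfl⟩ _
    refine ⟨F ∪ F', ?_⟩
    ext c
    simp only [Finset.mem_union, or_imp, forall_and, mem_ofPred_eq, mem_inter_iff]
  · rintro _ ⟨F, rfl⟩
    rw [hcyl hG, hcyl hA]
    exact (measureReal_eq_measureReal_iff).1 (h F)
  · rw [Measure.map_apply (measurable_mem_seq hG) .univ,
      Measure.map_apply (measurable_mem_seq hA) .univ, preimage_univ, preimage_univ]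

theorem exists_seq_ae_eventually_mem_iff {A : ℕ → MeasuredSets μ} (hA : DenseRange A)
    {U : Set X} (hU : MeasurableSet U) :
    ∃ i : ℕ → ℕ, ∀ᵐ x ∂μ, ∀ᶠ n in atTop, (x ∈ U ↔ x ∈ (A (i n) : Set X)) := by
  have hex : ∀ n : ℕ, ∃ i, μ (U ∆ (A i : Set X)) < (2⁻¹ : ENNReal) ^ n := fun n => by
    obtain ⟨_, ⟨i, rfl⟩, hi⟩ := EMetric.mem_closure_iff.1 (hA ⟨U, hU⟩) ((2⁻¹ : ENNReal) ^ n)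
      (ENNReal.pow_pos (by simp) n)
    exact ⟨i, hi⟩
  choose i hi using hex
  have hsum : ∑' n, μ (U ∆ (A (i n) : Set X)) < ⊤ :=
    (ENNReal.tsum_le_tsum fun n => (hi n).le).trans_lt (by simp)
  refine ⟨i, (ae_eventually_notMem hsum.ne).mono fun x hx => ?_⟩
  exact hx.mono fun n hn => notMem_symmDiff_iff.1 hn

theorem exists_measurable_ae_leftInverse [StandardBorelSpace X] [Nonempty X]
    {A : ℕ → MeasuredSets μ} (hA : DenseRange A) :
    ∃ r : (ℕ → Prop) → X, Measurable r ∧ ∀ᵐ x ∂μ, r (fun i => x ∈ (A i : Set X)) = x := by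
  classical
  have hm : MeasurableEmbedding (MeasurableSpace.mapNatBool X) :=
    (MeasurableSpace.measurable_mapNatBool X).measurableEmbedding
      (MeasurableSpace.injective_mapNatBool X)
  choose i hi using fun k => exists_seq_ae_eventually_mem_iff hA
    (MeasurableSpace.measurableSet_natGeneratingSequence (α := X) k)
  -- Membership in the `A i` determines, almost everywhere, membership in countably many
  -- generators of the σ-algebra, which separate points.
  let w : (ℕ → Prop) → (ℕ → Bool) := fun c k => decide (∃ N, ∀ n, N ≤ n → c (i k n))
  have hw : Measurable w := by
    refine measurable_pi_lambda _ fun k => measurable_to_bool ?_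
    have hpre : (fun c => w c k) ⁻¹' {true} = {c | ∃ N, ∀ n, N ≤ n → c (i k n)} := by
      ext c
      simp [w]
    rw [hpre]
    exact measurableSet_setOfPred.2 (by fun_prop)
  refine ⟨fun c => hm.invFun (w c), hm.measurable_invFun.comp hw, ?_⟩
  filter_upwards [ae_all_iff.2 hi] with x hx
  have hwx : w (fun i => x ∈ (A i : Set X)) = MeasurableSpace.mapNatBool X x := by
    funext k
    refine decide_eq_decide.2 ?_
    rw [← eventually_atTop, ← eventually_congr (hx k), eventually_const]
  rw [hwx]
  exact hm.leftInverse_invFun x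

theorem exists_measurePreserving_preimage_ae_eq [StandardBorelSpace X] [Nonempty X]
    [IsFiniteMeasure μ] {A : ℕ → MeasuredSets μ} (hA : DenseRange A) (G : ℕ → MeasuredSets μ)
    (h : ∀ F : Finset ℕ, μ.real (⋂ i ∈ F, (G i : Set X)) = μ.real (⋂ i ∈ F, (A i : Set X))) :
    ∃ f : X → X, MeasurePreserving f μ μ ∧
      ∀ i, (f ⁻¹' (A i : Set X) : Set X) =ᵐ[μ] (G i : Set X) := by
  obtain ⟨r, hr, hrA⟩ := exists_measurable_ae_leftInverse hA
  let a : X → ℕ → Prop := fun x i => x ∈ (A i : Set X)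
  let g : X → ℕ → Prop := fun x i => x ∈ (G i : Set X)
  have ha : Measurable a := measurable_mem_seq fun i => measurableSet_coe (A i)
  have hiso : AEIso μ (μ.map a) a r := AEIso.of_left_inv (ha.measurePreserving μ) hr hrA
  have hg : MeasurePreserving g μ (μ.map a) := ⟨measurable_mem_seq fun i => measurableSet_coe (G i),
    map_mem_seq_eq (fun i => measurableSet_coe (A i)) (fun i => (measurableSet_coe (G i))) h⟩
  refine ⟨fun x => r (g x), hiso.mp_inv.comp hg, fun i => ?_⟩
  filter_upwards [hg.quasiMeasurePreserving.ae hiso.right_inv] with x hx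
  exact congrFun hx i

variable [IsFiniteMeasure μ]

theorem measureReal_symmDiff_preimage_le {Y : Type*} [MeasurableSpace Y] {ν : Measure Y}
    {f g : X → Y} (hf : MeasurePreserving f μ ν) (hg : MeasurePreserving g μ ν) {B C : Set Y}
    (hB : MeasurableSet B) (hC : MeasurableSet C) :
    μ.real ((f ⁻¹' B) ∆ (g ⁻¹' B)) ≤ 2 * ν.real (B ∆ C) + μ.real ((f ⁻¹' C) ∆ (g ⁻¹' C)) := by
  have hpre : ∀ {R : X → Y}, MeasurePreserving R μ ν →
      μ.real ((R ⁻¹' B) ∆ (R ⁻¹' C)) = ν.real (B ∆ C) := fun {R} hR => by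
    rw [← preimage_symmDiff, hR.measureReal_preimage (hB.symmDiff hC).nullMeasurableSet]
  have h1 := measureReal_symmDiff_le (μ := μ) (s := f ⁻¹' B) (t := f ⁻¹' C) (g ⁻¹' B)
  have h2 := measureReal_symmDiff_le (μ := μ) (s := f ⁻¹' C) (t := g ⁻¹' C) (g ⁻¹' B)
  rw [hpre hf] at h1
  rw [symmDiff_comm (g ⁻¹' C), hpre hg] at h2
  linarith

theorem tendsto_measureReal_symmDiff_preimage {A : ℕ → MeasuredSets μ} (hA : DenseRange A)
    {t : ℕ → X → X} (ht : ∀ n, MeasurePreserving (t n) μ μ) {f : X → X}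
    (hf : MeasurePreserving f μ μ)
    (h : ∀ i, Tendsto (fun n => μ.real ((t n ⁻¹' (A i : Set X)) ∆ (f ⁻¹' (A i : Set X)))) atTop
      (𝓝 0)) {B : Set X} (hB : MeasurableSet B) :
    Tendsto (fun n => μ.real ((t n ⁻¹' B) ∆ (f ⁻¹' B))) atTop (𝓝 0) := by
  refine Metric.tendsto_atTop.2 fun ε hε => ?_
  obtain ⟨i, hi⟩ := Metric.denseRange_iff.1 hA ⟨B, hB⟩ (ε / 4) (by positivity)
  change μ.real (B ∆ (A i : Set X)) < ε / 4 at hi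
  obtain ⟨N, hN⟩ := Metric.tendsto_atTop.1 (h i) (ε / 2) (by positivity)
  refine ⟨N, fun n hn => ?_⟩
  have hAi := hN n hn
  rw [Real.dist_0_eq_abs, abs_of_nonneg measureReal_nonneg] at hAi ⊢
  have hle := measureReal_symmDiff_preimage_le (ht n) hf hB (measurableSet_coe (A i))
  linarith

theorem exists_measurePreserving_tendsto_preimage [StandardBorelSpace X] [Nonempty X]
    {A : ℕ → MeasuredSets μ} (hA : DenseRange A)
    {t : ℕ → X → X} (ht : ∀ n, MeasurePreserving (t n) μ μ)
    (hc : ∀ i, CauchySeq fun n =>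
      measuredSet μ (t n ⁻¹' (A i : Set X)) ((ht n).measurable (measurableSet_coe (A i)))) :
    ∃ f : X → X, MeasurePreserving f μ μ ∧ ∀ B, MeasurableSet B →
      Tendsto (fun n => μ.real ((t n ⁻¹' B) ∆ (f ⁻¹' B))) atTop (𝓝 0) := by
  choose G hG using fun i => cauchySeq_tendsto_of_complete (hc i)
  have hGlim : ∀ i, Tendsto (fun n => μ.real ((t n ⁻¹' (A i : Set X)) ∆ (G i : Set X))) atTop
      (𝓝 0) := fun i => tendsto_iff_dist_tendsto_zero.1 (hG i)
  have hinter : ∀ F : Finset ℕ,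
      μ.real (⋂ i ∈ F, (G i : Set X)) = μ.real (⋂ i ∈ F, (A i : Set X)) := fun F => by
    have hlim := tendsto_measureReal_biInter F
      (fun n i => (ht n).measurable (measurableSet_coe (A i)))
      (fun i => measurableSet_coe (G i)) hGlim
    refine tendsto_nhds_unique hlim (tendsto_const_nhds.congr fun n => ?_)
    rw [← (ht n).measureReal_preimage
      (F.measurableSet_biInter fun j _ => (measurableSet_coe (A j))).nullMeasurableSet]
    simp only [preimage_iInter]
  obtain ⟨f, hf, hfA⟩ := exists_measurePreserving_preimage_ae_eq hA G hinter
  refine ⟨f, hf, fun B hB => tendsto_measureReal_symmDiff_preimage hA ht hf (fun i => ?_) hB⟩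
  exact (hGlim i).congr fun n => measureReal_congr ((ae_eq_refl _).symmDiff (hfA i).symm)

theorem ae_eq_of_tendsto_preimage [StandardBorelSpace X] {s s' : ℕ → X → X}
    (hs : ∀ n, MeasurePreserving (s n) μ μ) (hs' : ∀ n, MeasurePreserving (s' n) μ μ)
    (hinv : ∀ n x, s n (s' n x) = x) {f f' : X → X} (hf : Measurable f)
    (h : ∀ B, MeasurableSet B → Tendsto (fun n => μ.real ((s n ⁻¹' B) ∆ (f ⁻¹' B))) atTop (𝓝 0))
    (h' : ∀ B, MeasurableSet B →
      Tendsto (fun n => μ.real ((s' n ⁻¹' B) ∆ (f' ⁻¹' B))) atTop (𝓝 0)) :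
    ∀ᵐ x ∂μ, f (f' x) = x := by
  refine EventuallyEq.of_forall_separating_preimage (f := fun x => f (f' x)) (g := id)
    MeasurableSet fun U hU => ?_
  rw [← measure_symmDiff_eq_zero_iff, ← measureReal_eq_zero_iff]
  have hfU := hf hU
  have hlim := (h' _ hfU).add (h U hU)
  rw [add_zero] at hlim
  refine le_antisymm (ge_of_tendsto' hlim fun n => ?_) measureReal_nonneg
  have hpull : μ.real ((s n ⁻¹' U) ∆ (f ⁻¹' U)) = μ.real ((s' n ⁻¹' (f ⁻¹' U)) ∆ U) := by
    rw [← (hs' n).measureReal_preimage (((hs n).measurable hU).symmDiff hfU).nullMeasurableSet,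
      preimage_symmDiff, ← preimage_comp, symmDiff_comm, show s n ∘ s' n = id from funext (hinv n),
      preimage_id]
  rw [hpull, symmDiff_comm (s' n ⁻¹' _)]
  exact measureReal_symmDiff_le (μ := μ) (s := f' ⁻¹' (f ⁻¹' U)) (t := s' n ⁻¹' (f ⁻¹' U)) U

end MeasuredSets

section HalmosTopology

variable {X : Type*} [MeasurableSpace X] {μ : Measure X}

theorem image_eq_preimage_inv (R : mpGroup μ) (B : Set X) :
    (R : Equiv.Perm X) '' B = ((R⁻¹ : mpGroup μ) : Equiv.Perm X) ⁻¹' B :=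
  Equiv.image_eq_preimage_symm _ _

theorem measurableSet_image (R : mpGroup μ) {B : Set X} (hB : MeasurableSet B) :
    MeasurableSet ((R : Equiv.Perm X) '' B) := by
  rw [image_eq_preimage_inv]
  exact (mpGroup_mp R⁻¹).measurable hB

theorem moveDist_mk_preimage (B : Set X) (S T : mpGroup μ) :
    moveDist B (S : Aut μ) (T : Aut μ) =
      μ.real ((((S⁻¹ : mpGroup μ) : Equiv.Perm X) ⁻¹' B) ∆
        (((T⁻¹ : mpGroup μ) : Equiv.Perm X) ⁻¹' B)) := by
  rw [moveDist_mk, image_eq_preimage_inv, image_eq_preimage_inv]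

theorem moveDist_inv_mk (B : Set X) (S T : mpGroup μ) :
    moveDist B (S : Aut μ)⁻¹ (T : Aut μ)⁻¹ =
      μ.real (((S : Equiv.Perm X) ⁻¹' B) ∆ ((T : Equiv.Perm X) ⁻¹' B)) := by
  rw [← QuotientGroup.mk_inv, ← QuotientGroup.mk_inv, moveDist_mk_preimage, inv_inv, inv_inv]

theorem moveDist_mul_right (B : Set X) (S T : Aut μ) (R : mpGroup μ) :
    moveDist B (S * (R : Aut μ)) (T * (R : Aut μ)) = moveDist ((R : Equiv.Perm X) '' B) S T := by
  induction S using QuotientGroup.induction_on with | H S => ?_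
  induction T using QuotientGroup.induction_on with | H T => ?_
  rw [← QuotientGroup.mk_mul, ← QuotientGroup.mk_mul, moveDist_mk, moveDist_mk, ← image_comp,
    ← image_comp]
  rfl

theorem moveDist_mul_left {B : Set X} (hB : MeasurableSet B) (U S T : Aut μ) :
    moveDist B (U * S) (U * T) = moveDist B S T := by
  induction U using QuotientGroup.induction_on with | H U => ?_
  induction S using QuotientGroup.induction_on with | H S => ?_
  induction T using QuotientGroup.induction_on with | H T => ?_
  have h : ∀ R : mpGroup μ, ((U * R : mpGroup μ) : Equiv.Perm X) '' B =
      (U : Equiv.Perm X) '' ((R : Equiv.Perm X) '' B) := fun R => by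
    rw [← image_comp]; rfl
  rw [← QuotientGroup.mk_mul, ← QuotientGroup.mk_mul, moveDist_mk, moveDist_mk, h, h,
    ← image_symmDiff (U : Equiv.Perm X).injective, image_eq_preimage_inv,
    (mpGroup_mp U⁻¹).measureReal_preimage
      ((measurableSet_image S hB).symmDiff (measurableSet_image T hB)).nullMeasurableSet]

theorem moveDist_eq_moveDist_inv_image {B : Set X} (hB : MeasurableSet B) (S : Aut μ)
    (T : mpGroup μ) :
    moveDist B S (T : Aut μ) = moveDist ((T : Equiv.Perm X) '' B) S⁻¹ (T : Aut μ)⁻¹ := by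
  rw [← moveDist_mul_right, inv_mul_cancel, ← moveDist_mul_left hB S (S⁻¹ * T) 1,
    mul_inv_cancel_left, mul_one, moveDist_comm]

theorem halmosDist_inv_inv (A : ℕ → MeasuredSets μ) (S T : Aut μ) :
    halmosDist A S⁻¹ T⁻¹ = halmosDist A S T := by
  simp only [halmosDist, inv_inv, add_comm]

theorem inv_ae_eq_of_ae_eq {S : mpGroup μ} {f f' : X → X} (hS : (S : Equiv.Perm X) =ᵐ[μ] f)
    (hf' : Measure.QuasiMeasurePreserving f' μ μ) (hinv : ∀ᵐ x ∂μ, f (f' x) = x) :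
    ((S⁻¹ : mpGroup μ) : Equiv.Perm X) =ᵐ[μ] f' := by
  filter_upwards [hf'.ae hS, hinv] with x hx hx'
  exact (Equiv.symm_apply_eq (S : Equiv.Perm X)).2 (hx.trans hx').symm

theorem joinLabel_preimage (T : mpGroup μ) (P : Finset ℤ) {n : ℕ} (f : X → Fin n)
    (c : P → Fin n) :
    joinLabel T P f ⁻¹' {c} = ⋂ p ∈ (Finset.univ : Finset P),
      ((T ^ (p : ℤ) : mpGroup μ) : Equiv.Perm X) '' (f ⁻¹' {c p}) := by
  ext x
  simp only [image_eq_preimage_inv, mem_preimage, mem_singleton_iff, Finset.mem_univ,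
    iInter_true, mem_iInter, ← zpow_neg]
  exact funext_iff

theorem joinEntropy_eq_sum_out (T : Aut μ) (P : Finset ℤ) {n : ℕ} (f : X → Fin n) :
    joinEntropy T P f =
      ∑ c, Real.negMulLog (μ.real (joinLabel (Quotient.out T) P f ⁻¹' {c})) := by
  conv_lhs => rw [← QuotientGroup.out_eq' T]
  rfl

variable [IsProbabilityMeasure μ]

theorem moveDist_le_add {B C : Set X} (hB : MeasurableSet B) (hC : MeasurableSet C)
    (S T : Aut μ) : moveDist B S T ≤ 2 * μ.real (B ∆ C) + moveDist C S T := by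
  induction S using QuotientGroup.induction_on with | H S => ?_
  induction T using QuotientGroup.induction_on with | H T => ?_
  rw [moveDist_mk_preimage, moveDist_mk_preimage]
  exact measureReal_symmDiff_preimage_le (mpGroup_mp S⁻¹) (mpGroup_mp T⁻¹) hB hC

theorem moveDist_le_halmosDist (A : ℕ → MeasuredSets μ) (S T : Aut μ) (i : ℕ) :
    moveDist (A i : Set X) S T ≤ 2 ^ (i + 1) * halmosDist A S T := by
  have hterm := (halmos_summable A S T).le_tsum i fun j _ => mul_nonneg (by positivity)
    (add_nonneg (moveDist_nonneg (A j : Set X) S T) (moveDist_nonneg (A j : Set X) S⁻¹ T⁻¹))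
  calc moveDist (A i : Set X) S T
      ≤ moveDist (A i : Set X) S T + moveDist (A i : Set X) S⁻¹ T⁻¹ :=
        le_add_of_nonneg_right (moveDist_nonneg _ _ _)
    _ = 2 ^ (i + 1) * ((1 / 2 : ℝ) ^ (i + 1) *
          (moveDist (A i : Set X) S T + moveDist (A i : Set X) S⁻¹ T⁻¹)) := by
        rw [← mul_assoc, ← mul_pow, mul_one_div_cancel two_ne_zero, one_pow, one_mul]
    _ ≤ 2 ^ (i + 1) * halmosDist A S T := mul_le_mul_of_nonneg_left hterm (by positivity)

theorem tendsto_halmosDist (A : ℕ → MeasuredSets μ) {u : ℕ → Aut μ} {S : Aut μ}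
    (h : ∀ i, Tendsto (fun n => moveDist (A i : Set X) (u n) S) atTop (𝓝 0))
    (h' : ∀ i, Tendsto (fun n => moveDist (A i : Set X) (u n)⁻¹ S⁻¹) atTop (𝓝 0)) :
    Tendsto (fun n => halmosDist A (u n) S) atTop (𝓝 0) := by
  have hlim := tendsto_tsum_of_dominated_convergence (𝓕 := atTop)
    (f := fun n i => (1 / 2 : ℝ) ^ (i + 1) *
      (moveDist (A i : Set X) (u n) S + moveDist (A i : Set X) (u n)⁻¹ S⁻¹))
    (g := fun _ => 0) (bound := fun i => (1 / 2 : ℝ) ^ i)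
    (summable_geometric_of_lt_one (by norm_num) (by norm_num))
    (fun i => by simpa using ((h i).add (h' i)).const_mul ((1 / 2 : ℝ) ^ (i + 1)))
    (Eventually.of_forall fun n i => by
      have hnn := moveDist_nonneg (A i : Set X) (u n) S
      have hnn' := moveDist_nonneg (A i : Set X) (u n)⁻¹ S⁻¹
      have hle := moveDist_le_one (A i : Set X) (u n) S
      have hle' := moveDist_le_one (A i : Set X) (u n)⁻¹ S⁻¹
      rw [Real.norm_of_nonneg (by positivity)]
      calc (1 / 2 : ℝ) ^ (i + 1) *
            (moveDist (A i : Set X) (u n) S + moveDist (A i : Set X) (u n)⁻¹ S⁻¹)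
          ≤ (1 / 2 : ℝ) ^ (i + 1) * 2 := by gcongr; linarith
        _ = (1 / 2 : ℝ) ^ i := by ring)
  simpa [halmosDist] using hlim

theorem tendsto_halmosDist_mk (A : ℕ → MeasuredSets μ) {s : ℕ → mpGroup μ} {S : mpGroup μ}
    {f f' : X → X} (hf : (S : Equiv.Perm X) =ᵐ[μ] f)
    (hf' : ((S⁻¹ : mpGroup μ) : Equiv.Perm X) =ᵐ[μ] f')
    (h : ∀ B, MeasurableSet B →
      Tendsto (fun n => μ.real (((s n : Equiv.Perm X) ⁻¹' B) ∆ (f ⁻¹' B))) atTop (𝓝 0))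
    (h' : ∀ B, MeasurableSet B →
      Tendsto (fun n => μ.real ((((s n)⁻¹ : mpGroup μ) ⁻¹' B : Set X) ∆ (f' ⁻¹' B))) atTop (𝓝 0)) :
    Tendsto (fun n => halmosDist A (s n : Aut μ) (S : Aut μ)) atTop (𝓝 0) := by
  have hpre : ∀ {a b : X → X}, a =ᵐ[μ] b → ∀ B : Set X,
      (b ⁻¹' B : Set X) =ᵐ[μ] (a ⁻¹' B : Set X) := fun hab B =>
    hab.symm.fun_comp (· ∈ B)
  refine tendsto_halmosDist A (fun i => ?_) fun i => ?_
  · refine (h' _ (measurableSet_coe (A i))).congr fun n => ?_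
    rw [moveDist_mk_preimage]
    exact measureReal_congr ((ae_eq_refl _).symmDiff (hpre hf' _))
  · refine (h _ (measurableSet_coe (A i))).congr fun n => ?_
    rw [moveDist_inv_mk]
    exact measureReal_congr ((ae_eq_refl _).symmDiff (hpre hf _))

variable [StandardBorelSpace X] {A : ℕ → MeasuredSets μ}

theorem exists_measurePreserving_tendsto_of_cauchySeq (hA : DenseRange A) {s : ℕ → mpGroup μ}
    (hs : letI := halmosMetric A hA; CauchySeq fun n => (s n : Aut μ)) :
    ∃ f : X → X, MeasurePreserving f μ μ ∧ ∀ B, MeasurableSet B →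
      Tendsto (fun n => μ.real (((s n : Equiv.Perm X) ⁻¹' B) ∆ (f ⁻¹' B))) atTop (𝓝 0) := by
  let _ := halmosMetric A hA
  have := nonempty_of_isProbabilityMeasure μ
  refine exists_measurePreserving_tendsto_preimage hA (fun n => mpGroup_mp (s n)) fun i => ?_
  rw [Metric.cauchySeq_iff] at hs ⊢
  intro ε hε
  obtain ⟨N, hN⟩ := hs (ε / 2 ^ (i + 1)) (by positivity)
  refine ⟨N, fun m hm n hn => ?_⟩
  have hmn : halmosDist A (s m : Aut μ) (s n : Aut μ) < ε / 2 ^ (i + 1) := hN m hm n hn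
  rw [lt_div_iff₀' (by positivity), ← halmosDist_inv_inv] at hmn
  have hmove := moveDist_le_halmosDist A (s m : Aut μ)⁻¹ (s n : Aut μ)⁻¹ i
  rw [moveDist_inv_mk] at hmove
  exact hmove.trans_lt hmn

theorem completeSpace_halmosMetric [NullSingletonClass μ] (hA : DenseRange A) :
    letI := halmosMetric A hA; CompleteSpace (Aut μ) := by
  let _ := halmosMetric A hA
  have := uncountable_of_nullSingletonClass μ
  refine Metric.complete_of_cauchySeq_tendsto fun u hu => ?_
  choose s hs using fun n => QuotientGroup.mk_surjective (u n)
  obtain rfl : (fun n => (s n : Aut μ)) = u := funext hs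
  have hu' : CauchySeq fun n => ((s n)⁻¹ : Aut μ) :=
    (Isometry.of_dist_eq fun S T => halmosDist_inv_inv A S T).uniformContinuous.comp_cauchySeq hu
  obtain ⟨f, hf, hlim⟩ := exists_measurePreserving_tendsto_of_cauchySeq hA hu
  obtain ⟨f', hf', hlim'⟩ := exists_measurePreserving_tendsto_of_cauchySeq hA hu'
  have hright : ∀ᵐ x ∂μ, f (f' x) = x :=
    ae_eq_of_tendsto_preimage (fun n => mpGroup_mp (s n)) (fun n => mpGroup_mp (s n)⁻¹)
      (fun n x => by simp) hf.measurable hlim hlim'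
  have hleft : ∀ᵐ x ∂μ, f' (f x) = x :=
    ae_eq_of_tendsto_preimage (fun n => mpGroup_mp (s n)⁻¹) (fun n => mpGroup_mp (s n))
      (fun n x => by simp) hf'.measurable hlim' hlim
  obtain ⟨S, hS⟩ := AEIso.exists_mpGroup ⟨hf, hf', hleft, hright⟩
  exact ⟨(S : Aut μ), tendsto_iff_dist_tendsto_zero.2 <| tendsto_halmosDist_mk A hS
    (inv_ae_eq_of_ae_eq hS hf'.quasiMeasurePreserving hright) hlim hlim'⟩

theorem tendsto_moveDist (hA : DenseRange A) {B : Set X} (hB : MeasurableSet B) (T₀ : Aut μ) :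
    letI := halmosMetric A hA; Tendsto (fun T => moveDist B T T₀) (𝓝 T₀) (𝓝 0) := by
  let _ := halmosMetric A hA
  refine Metric.tendsto_nhds_nhds.2 fun ε hε => ?_
  obtain ⟨i, hi⟩ := Metric.denseRange_iff.1 hA ⟨B, hB⟩ (ε / 4) (by positivity)
  change μ.real (B ∆ (A i : Set X)) < ε / 4 at hi
  refine ⟨ε / 2 / 2 ^ (i + 1), by positivity, fun T hT => ?_⟩
  change halmosDist A T T₀ < _ at hT
  rw [lt_div_iff₀' (by positivity)] at hT
  rw [Real.dist_0_eq_abs, abs_of_nonneg (moveDist_nonneg _ _ _)]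
  have hB_le := moveDist_le_add hB (measurableSet_coe (A i)) T T₀
  have hA_le := moveDist_le_halmosDist A T T₀ i
  linarith

theorem tendsto_moveDist_pow (hA : DenseRange A) {B : Set X} (hB : MeasurableSet B) (T₀ : Aut μ)
    (k : ℕ) : letI := halmosMetric A hA;
    Tendsto (fun T => moveDist B (T ^ k) (T₀ ^ k)) (𝓝 T₀) (𝓝 0) := by
  let _ := halmosMetric A hA
  induction k with
  | zero => simp [moveDist_self]
  | succ k ih =>
    obtain ⟨R, hR⟩ := QuotientGroup.mk_surjective (T₀ ^ k)
    have hlim := ih.add (tendsto_moveDist hA (measurableSet_image R hB) T₀)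
    rw [add_zero] at hlim
    refine squeeze_zero (fun T => moveDist_nonneg _ _ _) (fun T => ?_) hlim
    have htri := moveDist_triangle B (T * T ^ k) (T * T₀ ^ k) (T₀ * T₀ ^ k)
    rw [moveDist_mul_left hB, ← hR, moveDist_mul_right] at htri
    rwa [pow_succ', pow_succ', ← hR]

theorem continuous_joinEntropy (hA : DenseRange A) {P : Finset ℤ} (hP : ∀ p ∈ P, 0 ≤ p) {n : ℕ}
    {f : X → Fin n} (hf : Measurable f) :
    letI := halmosMetric A hA; Continuous fun T : Aut μ => joinEntropy T P f := by
  let _ := halmosMetric A hA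
  simp only [joinEntropy_eq_sum_out]
  refine continuous_finsetSum _ fun c _ => Real.continuous_negMulLog.comp ?_
  refine continuous_iff_continuousAt.2 fun T₀ => ?_
  have hm : ∀ p : P, MeasurableSet (f ⁻¹' {c p}) := fun p => hf (measurableSet_singleton _)
  have hlim : Tendsto (fun T : Aut μ => ∑ p : P, moveDist (f ⁻¹' {c p}) (T ^ (p : ℤ).toNat)
      (T₀ ^ (p : ℤ).toNat)) (𝓝 T₀) (𝓝 0) := by
    simpa using tendsto_finsetSum Finset.univ fun p _ =>
      tendsto_moveDist_pow hA (hm p) T₀ (p : ℤ).toNat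
  have hpow : ∀ (p : P) (T : Aut μ),
      T ^ (p : ℤ).toNat = ((Quotient.out T ^ (p : ℤ) : mpGroup μ) : Aut μ) := fun p T => by
    rw [QuotientGroup.mk_zpow, QuotientGroup.out_eq', ← zpow_natCast,
      Int.toNat_of_nonneg (hP p p.2)]
  refine tendsto_iff_dist_tendsto_zero.2 (squeeze_zero (fun _ => dist_nonneg) (fun T => ?_) hlim)
  simp only [Real.dist_eq, joinLabel_preimage, hpow, moveDist_mk]
  exact abs_measureReal_biInter_sub_le _ (fun p => measurableSet_image _ (hm p))
    fun p => measurableSet_image _ (hm p)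

end HalmosTopology

section JoinEntropy

variable {X : Type*} [MeasurableSpace X] {μ : Measure X} {n : ℕ} {f : X → Fin n}

theorem joinEntropy_mk (T : mpGroup μ) (P : Finset ℤ) (f : X → Fin n) :
    joinEntropy (T : Aut μ) P f =
      famEntropy μ (fun (p : ℤ) x => f (((T ^ (-p) : mpGroup μ) : Equiv.Perm X) x)) P :=
  rfl

theorem measurable_zpow_comp (T : mpGroup μ) (hf : Measurable f) (p : ℤ) :
    Measurable fun x => f (((T ^ (-p) : mpGroup μ) : Equiv.Perm X) x) :=
  hf.comp (mpGroup_mp _).measurable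

theorem joinEntropy_conj (J : mpGroup μ) (S : Aut μ) (P : Finset ℤ) (hf : Measurable f) :
    joinEntropy ((J : Aut μ)⁻¹ * S * (J : Aut μ)) P f =
      joinEntropy S P (f ∘ ((J⁻¹ : mpGroup μ) : Equiv.Perm X)) := by
  induction S using QuotientGroup.induction_on with | H S => ?_
  have hm : Measurable (joinLabel S P (f ∘ ((J⁻¹ : mpGroup μ) : Equiv.Perm X))) :=
    measurable_restrict_fam
      (measurable_zpow_comp S (hf.comp (mpGroup_mp J⁻¹).measurable)) P
  refine Eq.trans ?_ (partEntropy_comp_measurePreserving (mpGroup_mp J) hm)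
  change partEntropy μ (joinLabel (J⁻¹ * S * J) P f) = _
  congr 1
  funext x p
  have hconj : (J⁻¹ * S * J) ^ (-(p : ℤ)) = J⁻¹ * S ^ (-(p : ℤ)) * J := by
    simpa only [inv_inv] using conj_zpow (i := -(p : ℤ)) (a := J⁻¹) (b := S)
  change f (((J⁻¹ * S * J) ^ (-(p : ℤ)) : mpGroup μ).1 x) = _
  rw [hconj]
  rfl

theorem eventually_joinEntropy_Icc_lt {T : Aut μ} (hT : T ∈ zeroEntropy μ) (hf : Measurable f)
    {ε : ℝ} (hε : 0 < ε) :
    ∀ᶠ N : ℕ in atTop, joinEntropy T (Finset.Icc (0 : ℤ) N) f < ε * (N + 1) := by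
  have hlim : limsup (fun N : ℕ => ((joinEntropy T (Finset.Icc (0 : ℤ) N) f /
      ((Finset.Icc (0 : ℤ) N).card : ℝ) : ℝ) : EReal)) atTop ≤ entropy T :=
    le_iSup₂_of_le (f := fun (n : ℕ) (f : {f : X → Fin n // Measurable f}) =>
      limsup (fun j : ℕ => ((joinEntropy T (Finset.Icc (0 : ℤ) j) f.1 /
        ((Finset.Icc (0 : ℤ) j).card : ℝ) : ℝ) : EReal)) atTop) n ⟨f, hf⟩ le_rfl
  have hlt : entropy T < ε := by
    rw [show entropy T = 0 from hT]
    exact_mod_cast hε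
  filter_upwards [eventually_lt_of_limsup_lt (hlim.trans_lt hlt)] with N hN
  have hcard : ((Finset.Icc (0 : ℤ) N).card : ℝ) = N + 1 := by
    rw [Int.card_Icc, sub_zero]
    exact_mod_cast rfl
  rwa [EReal.coe_lt_coe_iff, hcard, div_lt_iff₀ (by positivity)] at hN

variable [IsProbabilityMeasure μ]

theorem joinEntropy_mono (T : Aut μ) {P Q : Finset ℤ} (h : P ⊆ Q) (hf : Measurable f) :
    joinEntropy T P f ≤ joinEntropy T Q f := by
  induction T using QuotientGroup.induction_on with | H T => ?_
  exact famEntropy_mono (measurable_zpow_comp T hf) h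

theorem joinEntropy_union_le (T : Aut μ) (P Q : Finset ℤ) (hf : Measurable f) :
    joinEntropy T (P ∪ Q) f ≤ joinEntropy T P f + joinEntropy T Q f := by
  induction T using QuotientGroup.induction_on with | H T => ?_
  exact famEntropy_union_le (measurable_zpow_comp T hf) P Q

theorem joinEntropy_empty (T : Aut μ) : joinEntropy T ∅ f = 0 := by
  induction T using QuotientGroup.induction_on with | H T => ?_
  rw [joinEntropy_mk, famEntropy_empty]

theorem joinEntropy_image_add_le (T : Aut μ) (P : Finset ℤ) (a : ℤ) (hf : Measurable f) :
    joinEntropy T (P.image (· + a)) f ≤ joinEntropy T P f := by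
  induction T using QuotientGroup.induction_on with | H T => ?_
  have hm : Measurable (joinLabel T P f) := measurable_restrict_fam (measurable_zpow_comp T hf) P
  refine (famEntropy_image_le (measurable_zpow_comp T hf) (· + a) P).trans_eq ?_
  refine Eq.trans ?_ (partEntropy_comp_measurePreserving (mpGroup_mp (T ^ (-a))) hm)
  rw [famEntropy]
  congr 1
  funext x p
  rw [neg_add, zpow_add]
  rfl

/-- The finite arithmetic progression `{j k : k < L}` of integers. -/
def progression (j L : ℕ) : Finset ℤ := (Finset.range L).image fun k : ℕ => (j * k : ℤ)

theorem mem_progression {j L : ℕ} {p : ℤ} : p ∈ progression j L ↔ ∃ k < L, (j * k : ℤ) = p := by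
  simp only [progression, Finset.mem_image, Finset.mem_range]

theorem nonneg_of_mem_progression {j L : ℕ} {p : ℤ} (hp : p ∈ progression j L) : 0 ≤ p := by
  obtain ⟨k, _, rfl⟩ := mem_progression.1 hp
  positivity

theorem progression_succ (j L : ℕ) :
    progression j (L + 1) = insert (j * L : ℤ) (progression j L) := by
  rw [progression, Finset.range_add_one, Finset.image_insert, progression]

theorem progression_subset_Icc (j L : ℕ) :
    progression j L ⊆ Finset.Icc (0 : ℤ) ((j * L : ℕ) : ℤ) := fun p hp => by
  obtain ⟨k, hk, rfl⟩ := mem_progression.1 hp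
  exact Finset.mem_Icc.2 ⟨by positivity, mod_cast Nat.mul_le_mul_left j hk.le⟩

theorem card_progression_le (j L : ℕ) : (progression j L).card ≤ L :=
  Finset.card_image_le.trans_eq (Finset.card_range L)

theorem progression_add_subset (j K L : ℕ) : progression j (K + L) ⊆
    progression j K ∪ (progression j L).image (· + (j * K : ℤ)) := fun p hp => by
  obtain ⟨k, hk, rfl⟩ := mem_progression.1 hp
  rcases lt_or_ge k K with h | h
  · exact Finset.mem_union_left _ (mem_progression.2 ⟨k, h, rfl⟩)
  · obtain ⟨m, rfl⟩ := Nat.exists_eq_add_of_le' h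
    refine Finset.mem_union_right _ (Finset.mem_image.2 ⟨(j * m : ℤ), ?_, by push_cast; ring⟩)
    exact mem_progression.2 ⟨m, by lia, rfl⟩

theorem joinEntropy_progression_mul_le (T : Aut μ) (j m L : ℕ) (hf : Measurable f) :
    joinEntropy T (progression j (m * L)) f ≤ m * joinEntropy T (progression j L) f := by
  induction m with
  | zero => simp [progression, joinEntropy_empty]
  | succ m ih => calc
      joinEntropy T (progression j ((m + 1) * L)) f
        ≤ joinEntropy T (progression j (m * L) ∪
            (progression j L).image (· + (j * (m * L : ℕ) : ℤ))) f := by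
          rw [Nat.succ_mul]
          exact joinEntropy_mono T (progression_add_subset j (m * L) L) hf
      _ ≤ joinEntropy T (progression j (m * L)) f + joinEntropy T (progression j L) f :=
          (joinEntropy_union_le T _ _ hf).trans
            (add_le_add_right (joinEntropy_image_add_le T _ _ hf) _)
      _ ≤ (m + 1 : ℕ) * joinEntropy T (progression j L) f := by
          push_cast
          linarith

theorem exists_joinEntropy_progression_lt {T : Aut μ} (hT : T ∈ zeroEntropy μ) (hf : Measurable f)
    {j : ℕ} (hj : 0 < j) {δ : ℝ} (hδ : 0 < δ) :
    ∃ L : ℕ, 0 < L ∧ joinEntropy T (progression j L) f < δ * L := by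
  have hε : 0 < δ / (j + 1) := by positivity
  obtain ⟨N, hN⟩ := eventually_atTop.1 (eventually_joinEntropy_Icc_lt hT hf hε)
  refine ⟨N + 1, N.succ_pos, ?_⟩
  calc joinEntropy T (progression j (N + 1)) f
      ≤ joinEntropy T (Finset.Icc (0 : ℤ) ((j * (N + 1) : ℕ) : ℤ)) f :=
        joinEntropy_mono T (progression_subset_Icc j (N + 1)) hf
    _ < δ / (j + 1) * ((j * (N + 1) : ℕ) + 1) :=
        hN _ ((Nat.le_succ N).trans (Nat.le_mul_of_pos_left _ hj))
    _ ≤ δ / (j + 1) * ((j + 1) * (N + 1)) := by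
        gcongr
        push_cast
        linarith [(Nat.cast_nonneg N : (0 : ℝ) ≤ N)]
    _ = δ * (N + 1 : ℕ) := by
        push_cast
        field_simp

theorem joinEntropy_progression_mul_lt {T : Aut μ} {j L m : ℕ} (hf : Measurable f) (hm : 0 < m)
    {δ : ℝ} (h : joinEntropy T (progression j L) f < δ * L) :
    joinEntropy T (progression j (m * L)) f < δ * (m * L : ℕ) := calc
  joinEntropy T (progression j (m * L)) f ≤ m * joinEntropy T (progression j L) f :=
    joinEntropy_progression_mul_le T j m L hf
  _ < m * (δ * L) := mul_lt_mul_of_pos_left h (mod_cast hm)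
  _ = δ * (m * L : ℕ) := by
    push_cast
    ring

theorem exists_uniform_joinEntropy_lt [StandardBorelSpace X] {A : ℕ → MeasuredSets μ}
    (hA : DenseRange A) {K : Set (Aut μ)} (hKE : K ⊆ zeroEntropy μ)
    (hK : letI := halmosMetric A hA; IsCompact K) (hf : Measurable f) {j : ℕ} (hj : 0 < j) {δ : ℝ}
    (hδ : 0 < δ) :
    ∃ L : ℕ, 0 < L ∧ ∀ m : ℕ, 0 < m → ∀ T ∈ K,
      joinEntropy T (progression j (m * L)) f < δ * (m * L : ℕ) := by
  let _ := halmosMetric A hA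
  -- The bound is asked for at all multiples of `L` so that lengths `L` and `L'` for two subsets
  -- of `K` combine to the length `L * L'` for their union.
  refine hK.induction_on (p := fun s => ∃ L : ℕ, 0 < L ∧ ∀ m : ℕ, 0 < m → ∀ T ∈ s,
      joinEntropy T (progression j (m * L)) f < δ * (m * L : ℕ)) ?_ ?_ ?_ fun T hT => ?_
  · exact ⟨1, one_pos, fun _ _ _ h => h.elim⟩
  · rintro s t hst ⟨L, hL, h⟩
    exact ⟨L, hL, fun m hm T hT => h m hm T (hst hT)⟩
  · rintro s t ⟨L, hL, h⟩ ⟨L', hL', h'⟩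
    refine ⟨L * L', Nat.mul_pos hL hL', fun m hm T hT => hT.elim (fun hT => ?_) fun hT => ?_⟩
    · rw [mul_comm L, ← mul_assoc]
      exact h (m * L') (Nat.mul_pos hm hL') T hT
    · rw [← mul_assoc]
      exact h' (m * L) (Nat.mul_pos hm hL) T hT
  · obtain ⟨L, hL, h⟩ := exists_joinEntropy_progression_lt (hKE hT) hf hj hδ
    have hopen : IsOpen {T' : Aut μ | joinEntropy T' (progression j L) f < δ * L} :=
      isOpen_lt (continuous_joinEntropy hA (fun _ => nonneg_of_mem_progression) hf)
        continuous_const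
    exact ⟨_, mem_nhdsWithin_of_mem_nhds (hopen.mem_nhds h), L, hL,
      fun m hm T' hT' => joinEntropy_progression_mul_lt hf hm hT'⟩

end JoinEntropy

section IndicatorLabel

variable {X : Type*} [MeasurableSpace X] {μ : Measure X} {B C : Set X}

open Classical in
/-- The labelling whose level sets form the partition `{B, Bᶜ}`. -/
noncomputable def indicatorLabel (B : Set X) : X → Fin 2 := fun x => if x ∈ B then 1 else 0

theorem indicatorLabel_preimage_one {X : Type*} (B : Set X) : indicatorLabel B ⁻¹' {1} = B := by
  ext x
  by_cases h : x ∈ B <;> simp [indicatorLabel, h]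

theorem measurable_indicatorLabel (hB : MeasurableSet B) : Measurable (indicatorLabel B) :=
  Measurable.ite hB measurable_const measurable_const

theorem joinEntropy_conj_indicatorLabel (J : mpGroup μ) (S : Aut μ) (P : Finset ℤ)
    (hB : MeasurableSet B) :
    joinEntropy ((J : Aut μ)⁻¹ * S * (J : Aut μ)) P (indicatorLabel B) =
      joinEntropy S P (indicatorLabel ((J : Equiv.Perm X) '' B)) := by
  rw [joinEntropy_conj J S P (measurable_indicatorLabel hB), image_eq_preimage_inv]
  rfl

variable [IsProbabilityMeasure μ]

theorem partEntropy_indicatorLabel (hB : MeasurableSet B) :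
    partEntropy μ (indicatorLabel B) = Real.binEntropy (μ.real B) := by
  rw [partEntropy_fin_two (measurable_indicatorLabel hB), indicatorLabel_preimage_one]

theorem joinEntropy_indicatorLabel_le (T : Aut μ) (P : Finset ℤ) (hB : MeasurableSet B)
    (hC : MeasurableSet C) :
    joinEntropy T P (indicatorLabel B) ≤
      joinEntropy T P (indicatorLabel C) + P.card * Real.binEntropy (μ.real (B ∆ C)) := by
  induction T using QuotientGroup.induction_on with | H T => ?_
  have hD := measurable_indicatorLabel (hB.symmDiff hC)
  have hflip : ∀ y, indicatorLabel B y =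
      if indicatorLabel (B ∆ C) y = 0 then indicatorLabel C y else 1 - indicatorLabel C y := by
    intro y
    by_cases hyB : y ∈ B <;> by_cases hyC : y ∈ C <;> simp [indicatorLabel, mem_symmDiff, hyB, hyC]
  have hentropy : ∀ p : ℤ, partEntropy μ (fun x =>
      indicatorLabel (B ∆ C) (((T ^ (-p) : mpGroup μ) : Equiv.Perm X) x)) =
        Real.binEntropy (μ.real (B ∆ C)) := fun p => by
    rw [partEntropy_comp_measurePreserving (mpGroup_mp _) hD,
      partEntropy_indicatorLabel (hB.symmDiff hC)]
  have hle := famEntropy_le_add_sum (P := μ) (measurable_zpow_comp T (measurable_indicatorLabel hC))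
    (measurable_zpow_comp T hD) (fun c d => if d = 0 then c else 1 - c) (fun p x => hflip _) P
  simpa only [joinEntropy_mk, hentropy, Finset.sum_const, nsmul_eq_mul] using hle

end IndicatorLabel

section Bernoulli

variable {W : Type*}

/-- The shift by `k` of two-sided sequences. -/
def shiftBy (k : ℤ) (y : ℤ → W) : ℤ → W := fun n => y (n + k)

theorem shiftBy_shiftBy (k l : ℤ) (y : ℤ → W) : shiftBy k (shiftBy l y) = shiftBy (k + l) y := by
  funext n
  simp only [shiftBy, add_assoc]

theorem shiftBy_zero (y : ℤ → W) : shiftBy 0 y = y := by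
  funext n
  simp only [shiftBy, add_zero]

variable [mW : MeasurableSpace W]

variable (W) in
/-- The σ-algebra of two-sided sequences generated by the coordinates in `S`. -/
@[reducible]
def coordAlg (S : Set ℤ) : MeasurableSpace (ℤ → W) := ⨆ i ∈ S, mW.comap fun y => y i

theorem measurable_coordAlg {S : Set ℤ} {i : ℤ} (hi : i ∈ S) :
    Measurable[coordAlg W S] fun y : ℤ → W => y i := by
  rw [measurable_iff_comap_le]
  exact le_iSup₂ (f := fun (i : ℤ) (_ : i ∈ S) => mW.comap fun y : ℤ → W => y i) i hi

theorem coordAlg_le (S : Set ℤ) : coordAlg W S ≤ MeasurableSpace.pi :=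
  iSup₂_le fun i _ => (measurable_pi_apply i).comap_le

theorem coordAlg_mono {S S' : Set ℤ} (h : S ⊆ S') : coordAlg W S ≤ coordAlg W S' :=
  biSup_mono fun _ hi => h hi

theorem measurable_shiftBy_coordAlg {S S' : Set ℤ} {k : ℤ} (h : ∀ i ∈ S, i + k ∈ S') :
    @Measurable _ _ (coordAlg W S') (coordAlg W S) (shiftBy k) := by
  rw [measurable_iff_comap_le]
  simp only [coordAlg, MeasurableSpace.comap_iSup, MeasurableSpace.comap_comp]
  exact iSup₂_le fun i hi => (measurable_coordAlg (h i hi)).comap_le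

variable (Q : Measure W) [IsProbabilityMeasure Q]

/-- The Bernoulli measure: the law of a two-sided sequence of independent points with law `Q`. -/
noncomputable abbrev iidMeasure : Measure (ℤ → W) := Measure.infinitePi fun _ : ℤ => Q

theorem measurePreserving_shiftBy (k : ℤ) :
    MeasurePreserving (shiftBy k) (iidMeasure Q) (iidMeasure Q) :=
  ⟨measurable_pi_lambda _ fun _ => measurable_pi_apply _,
    Measure.map_infinitePi_infinitePi_of_inj (P := fun _ : ℤ => Q) (add_left_injective k)⟩

theorem measurePreserving_coord (i : ℤ) :
    MeasurePreserving (fun y : ℤ → W => y i) (iidMeasure Q) Q :=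
  measurePreserving_eval_infinitePi (fun _ : ℤ => Q) i

theorem aeIso_shiftBy (k : ℤ) :
    AEIso (iidMeasure Q) (iidMeasure Q) (shiftBy k) (shiftBy (-k)) :=
  ⟨measurePreserving_shiftBy Q k, measurePreserving_shiftBy Q (-k),
    Eventually.of_forall fun y => by rw [shiftBy_shiftBy, neg_add_cancel, shiftBy_zero],
    Eventually.of_forall fun y => by rw [shiftBy_shiftBy, add_neg_cancel, shiftBy_zero]⟩

theorem nullSingletonClass_iidMeasure [NullSingletonClass Q] :
    NullSingletonClass (iidMeasure Q) where
  measure_singleton y := by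
    refine measure_mono_null (t := (fun z : ℤ → W => z 0) ⁻¹' {y 0}) ?_ ?_
    · exact singleton_subset_iff.2 rfl
    · exact (measurePreserving_coord Q 0).quasiMeasurePreserving.preimage_null
        (measure_singleton _)

theorem indep_coordAlg {S S' : Set ℤ} (h : Disjoint S S') :
    Indep (coordAlg W S) (coordAlg W S') (iidMeasure Q) :=
  indep_iSup_of_disjoint (fun i => (measurable_pi_apply i).comap_le)
    (iIndepFun_infinitePi (P := fun _ : ℤ => Q) (X := fun _ w => w) fun _ => measurable_id) h

end Bernoulli

section Resampling

variable {X : Type*}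

/-- The state at time `0` of the process that at each time moves by `T` or, if the coin shows
`true`, starts afresh from a random point. Time `n` supplies the coin and the point `y n`; the
memory is cut at depth `N`, by starting afresh at time `-N` at the latest, so that only the
coordinates in `[-N, 0]` matter. -/
def resample (T : X → X) : ℕ → (ℤ → Bool × X) → X
  | 0, y => (y 0).2
  | N + 1, y => if (y 0).1 = true then (y 0).2 else T (resample T N (shiftBy (-1) y))

theorem resample_succ_of_true {T : X → X} {N : ℕ} {y : ℤ → Bool × X} (h : (y 0).1 = true) :
    resample T (N + 1) y = (y 0).2 :=
  if_pos h

theorem resample_succ_of_false {T : X → X} {N : ℕ} {y : ℤ → Bool × X} (h : (y 0).1 = false) :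
    resample T (N + 1) y = T (resample T N (shiftBy (-1) y)) :=
  if_neg (by simp [h])

theorem resample_succ_preimage (T : X → X) (N : ℕ) (C : Set X) :
    resample T (N + 1) ⁻¹' C = ((fun y : ℤ → Bool × X => y 0) ⁻¹' ({true} ×ˢ C)) ∪
      ({y | (y 0).1 = false} ∩ shiftBy (-1) ⁻¹' (resample T N ⁻¹' (T ⁻¹' C))) := by
  ext y
  rcases h : (y 0).1 with _ | _
  · simp [resample_succ_of_false h, h]
  · simp [resample_succ_of_true h, h]

variable [MeasurableSpace X] {T : X → X}

theorem measurableSet_coin (b : Bool) {S : Set ℤ} {i : ℤ} (hi : i ∈ S) :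
    MeasurableSet[coordAlg (Bool × X) S] {y : ℤ → Bool × X | (y i).1 = b} :=
  (measurable_fst.comp (measurable_coordAlg hi)) (measurableSet_singleton b)

theorem measurable_resample (hT : Measurable T) (N : ℕ) :
    Measurable[coordAlg (Bool × X) (Icc (-N : ℤ) 0)] (resample T N) := by
  induction N with
  | zero => exact measurable_snd.comp (measurable_coordAlg (by simp))
  | succ N ih =>
    have h0 : (0 : ℤ) ∈ Icc (-(N + 1 : ℕ) : ℤ) 0 := by constructor <;> simp
    refine @Measurable.ite _ _ (_) _ _ _ _ _ (measurableSet_coin true h0)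
      (measurable_snd.comp (measurable_coordAlg h0))
      (hT.comp (ih.comp (measurable_shiftBy_coordAlg ?_)))
    rintro i ⟨hi, hi'⟩
    constructor <;> push_cast <;> lia

theorem measurable_resample_shiftBy (hT : Measurable T) (N : ℕ) {p : ℤ} {S : Set ℤ}
    (hS : Icc (-N - p : ℤ) (-p) ⊆ S) :
    Measurable[coordAlg (Bool × X) S] fun y => resample T N (shiftBy (-p) y) := by
  refine (measurable_resample hT N).comp (measurable_shiftBy_coordAlg ?_)
  rintro i ⟨hi, hi'⟩
  exact hS ⟨by lia, by lia⟩

theorem measurable_resample_pi (hT : Measurable T) (N : ℕ) : Measurable (resample T N) :=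
  (measurable_resample hT N).mono (coordAlg_le _) le_rfl

theorem measurableSet_resample_succ_ne [StandardBorelSpace X] (hT : Measurable T) (N : ℕ) :
    MeasurableSet[coordAlg (Bool × X) (Icc (-(N + 1 : ℕ) : ℤ) 0)]
      {y | resample T (N + 1) y ≠ resample T N y} := by
  have hsub : Icc (-N : ℤ) 0 ⊆ Icc (-(N + 1 : ℕ) : ℤ) 0 :=
    Icc_subset_Icc_left (by push_cast; lia)
  exact @MeasurableSet.compl _ _ (_) (@measurableSet_eq_fun _ _ (_) _ _ _ _
    (measurable_resample hT (N + 1)) ((measurable_resample hT N).mono (coordAlg_mono hsub) le_rfl))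

variable (κ : Measure Bool) [IsProbabilityMeasure κ] {μ : Measure X} [IsProbabilityMeasure μ]

theorem measure_coin_eq (b : Bool) (i : ℤ) :
    iidMeasure (κ.prod μ) {y | (y i).1 = b} = κ {b} :=
  (measurePreserving_fst.comp (measurePreserving_coord (κ.prod μ) i)).measure_preimage
    (measurableSet_singleton b).nullMeasurableSet

theorem measure_coin_inter_shiftBy (b : Bool) {N : ℕ} {D : Set (ℤ → Bool × X)}
    (hD : MeasurableSet[coordAlg (Bool × X) (Icc (-N : ℤ) 0)] D) :
    iidMeasure (κ.prod μ) ({y | (y 0).1 = b} ∩ shiftBy (-1) ⁻¹' D) =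
      κ {b} * iidMeasure (κ.prod μ) D := by
  have hpast : MeasurableSet[coordAlg (Bool × X) (Iio 0)] (shiftBy (-1) ⁻¹' D) := by
    refine measurable_shiftBy_coordAlg (S := Icc (-N : ℤ) 0) ?_ hD
    rintro i ⟨_, hi⟩
    rw [mem_Iio]
    lia
  have hind := Indep_iff _ _ _ |>.1 <| indep_coordAlg (κ.prod μ) (S := {0}) (S' := Iio 0) (by simp)
  rw [hind _ _ (measurableSet_coin b (mem_singleton 0)) hpast, measure_coin_eq,
    (measurePreserving_shiftBy _ _).measure_preimage (coordAlg_le _ _ hD).nullMeasurableSet]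

theorem measurePreserving_resample (hT : MeasurePreserving T μ μ) (N : ℕ) :
    MeasurePreserving (resample T N) (iidMeasure (κ.prod μ)) μ := by
  induction N with
  | zero => exact measurePreserving_snd.comp (measurePreserving_coord (κ.prod μ) 0)
  | succ N ih =>
    refine ⟨measurable_resample_pi hT.measurable _, Measure.ext fun C hC => ?_⟩
    have hD : MeasurableSet[coordAlg (Bool × X) (Icc (-N : ℤ) 0)]
        (resample T N ⁻¹' (T ⁻¹' C)) := measurable_resample hT.measurable N (hT.measurable hC)
    have hm : MeasurableSet ({y : ℤ → Bool × X | (y 0).1 = false} ∩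
        shiftBy (-1) ⁻¹' (resample T N ⁻¹' (T ⁻¹' C))) :=
      (coordAlg_le _ _ (measurableSet_coin false (mem_univ 0))).inter
        ((measurePreserving_shiftBy (κ.prod μ) (-1)).measurable (coordAlg_le _ _ hD))
    have hdisj : Disjoint ((fun y : ℤ → Bool × X => y 0) ⁻¹' ({true} ×ˢ C))
        ({y | (y 0).1 = false} ∩ shiftBy (-1) ⁻¹' (resample T N ⁻¹' (T ⁻¹' C))) :=
      Set.disjoint_left.2 fun y h h' => Bool.false_ne_true (h'.1.symm.trans h.1)
    have hκ : κ {true} + κ {false} = 1 := by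
      simpa using prob_add_prob_compl (μ := κ) (measurableSet_singleton true)
    calc Measure.map (resample T (N + 1)) (iidMeasure (κ.prod μ)) C
      _ = κ {true} * μ C + κ {false} * μ C := by
        rw [Measure.map_apply (measurable_resample_pi hT.measurable _) hC, resample_succ_preimage,
          measure_union hdisj hm, measure_coin_inter_shiftBy κ false hD,
          (measurePreserving_coord (κ.prod μ) 0).measure_preimage
            ((measurableSet_singleton true).prod hC).nullMeasurableSet, Measure.prod_prod,
          ih.measure_preimage (hT.measurable hC).nullMeasurableSet,
          hT.measure_preimage hC.nullMeasurableSet]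
      _ = μ C := by rw [← add_mul, hκ, one_mul]

theorem measure_resample_succ_ne_le [StandardBorelSpace X] (hT : Measurable T) (N : ℕ) :
    iidMeasure (κ.prod μ) {y | resample T (N + 1) y ≠ resample T N y} ≤ κ {false} ^ N := by
  induction N with
  | zero => simpa using prob_le_one
  | succ N ih =>
    calc iidMeasure (κ.prod μ) {y | resample T (N + 1 + 1) y ≠ resample T (N + 1) y}
        ≤ iidMeasure (κ.prod μ) ({y | (y 0).1 = false} ∩
          shiftBy (-1) ⁻¹' {y | resample T (N + 1) y ≠ resample T N y}) := by
          refine measure_mono fun y hy => ?_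
          rcases h : (y 0).1 with _ | _
          · refine ⟨h, fun heq => hy ?_⟩
            rw [resample_succ_of_false h, resample_succ_of_false h, heq]
          · exact absurd ((resample_succ_of_true h).trans (resample_succ_of_true h).symm) hy
      _ = κ {false} * iidMeasure (κ.prod μ) {y | resample T (N + 1) y ≠ resample T N y} :=
          measure_coin_inter_shiftBy κ false (measurableSet_resample_succ_ne hT N)
      _ ≤ κ {false} * κ {false} ^ N := by gcongr
      _ = κ {false} ^ (N + 1) := (pow_succ' _ _).symm

theorem measure_resample_shiftBy_ne_le [StandardBorelSpace X] (hT : Measurable T) (N : ℕ) :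
    iidMeasure (κ.prod μ) {y | resample T N (shiftBy 1 y) ≠ T (resample T N y)} ≤
      κ {false} ^ N + κ {true} := by
  have hD : MeasurableSet {y | resample T (N + 1) y ≠ resample T N y} :=
    coordAlg_le _ _ (measurableSet_resample_succ_ne hT N)
  calc iidMeasure (κ.prod μ) {y | resample T N (shiftBy 1 y) ≠ T (resample T N y)}
      ≤ iidMeasure (κ.prod μ) (shiftBy 1 ⁻¹' {y | resample T (N + 1) y ≠ resample T N y} ∪
        {y | (y 1).1 = true}) := by
        refine measure_mono fun y hy => ?_
        rcases h : (y 1).1 with _ | _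
        · have hstep := resample_succ_of_false (T := T) (N := N) (y := shiftBy 1 y) h
          rw [shiftBy_shiftBy, neg_add_cancel, shiftBy_zero] at hstep
          exact Or.inl fun heq => hy (heq.symm.trans hstep)
        · exact Or.inr h
    _ ≤ iidMeasure (κ.prod μ) {y | resample T (N + 1) y ≠ resample T N y} + κ {true} := by
        refine (measure_union_le _ _).trans_eq ?_
        rw [measure_coin_eq, (measurePreserving_shiftBy _ _).measure_preimage hD.nullMeasurableSet]
    _ ≤ κ {false} ^ N + κ {true} := by
        gcongr
        exact measure_resample_succ_ne_le κ hT N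

variable {ι : Type*} [MeasurableSpace ι] {f : X → ι}

theorem indepFun_resample_shiftBy (hT : Measurable T) (hf : Measurable f) {N : ℕ} {q : ℤ}
    {P : Finset ℤ} (hP : ∀ p ∈ P, p + N < q) :
    IndepFun (fun y => f (resample T N (shiftBy (-q) y)))
      (fun y (p : P) => f (resample T N (shiftBy (-(p : ℤ)) y))) (iidMeasure (κ.prod μ)) := by
  have hpast : Measurable[coordAlg (Bool × X) (Iic (-q))]
      fun y => f (resample T N (shiftBy (-q) y)) :=
    hf.comp (measurable_resample_shiftBy hT N fun _ hi => hi.2)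
  have hfuture : Measurable[coordAlg (Bool × X) (Ioi (-q))]
      fun y (p : P) => f (resample T N (shiftBy (-(p : ℤ)) y)) := by
    refine @measurable_pi_lambda _ _ _ (_) _ _ fun p =>
      hf.comp (measurable_resample_shiftBy hT N ?_)
    rintro i ⟨hi, _⟩
    have := hP p p.2
    rw [mem_Ioi]
    lia
  exact indep_of_indep_of_le_left (indep_of_indep_of_le_right
    (indep_coordAlg (κ.prod μ) (Iic_disjoint_Ioi le_rfl)) hfuture.comap_le) hpast.comap_le

theorem mul_partEntropy_le_famEntropy_resample [Fintype ι] [MeasurableSingletonClass ι]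
    (hT : MeasurePreserving T μ μ) (hf : Measurable f) {N j : ℕ} (hj : N < j) (L : ℕ) :
    L * partEntropy μ f ≤ famEntropy (iidMeasure (κ.prod μ))
      (fun (p : ℤ) y => f (resample T N (shiftBy (-p) y))) (progression j L) := by
  have hmp : ∀ p : ℤ, MeasurePreserving (fun y => resample T N (shiftBy (-p) y))
      (iidMeasure (κ.prod μ)) μ := fun p =>
    (measurePreserving_resample κ hT N).comp (measurePreserving_shiftBy (κ.prod μ) (-p))
  induction L with
  | zero => simp [progression, famEntropy_empty]
  | succ L ih =>
    have hgap : ∀ p ∈ progression j L, p + N < j * L := fun p hp => by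
      obtain ⟨k, hk, rfl⟩ := mem_progression.1 hp
      have : j * (k + 1) ≤ j * L := Nat.mul_le_mul_left j hk
      zify at this hj
      linarith
    have hind := indepFun_resample_shiftBy κ (μ := μ) hT.measurable hf hgap
    have hinsert := add_famEntropy_le_famEntropy_insert
      (F := fun (p : ℤ) y => f (resample T N (shiftBy (-p) y)))
      (fun p => hf.comp (hmp p).measurable) hind
    rw [partEntropy_comp_measurePreserving (hmp _) hf] at hinsert
    rw [progression_succ]
    push_cast
    linarith

end Resampling

section Density

theorem exists_coin {δ : ℝ} (hδ : 0 < δ) :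
    ∃ κ : Measure Bool, IsProbabilityMeasure κ ∧
      ∃ N : ℕ, κ {false} ^ N + κ {true} ≤ ENNReal.ofReal δ := by
  obtain ⟨c, hc0, hcδ⟩ := exists_between (lt_min (half_pos hδ) one_pos)
  obtain ⟨hcδ, hc1⟩ := lt_min_iff.1 hcδ
  obtain ⟨N, hN⟩ := exists_pow_lt_of_lt_one (half_pos hδ) (by linarith : 1 - c < 1)
  let p : unitInterval := ⟨c, hc0.le, hc1.le⟩
  have htrue : (bernoulliMeasure true false p) {true} = ENNReal.ofReal c := by
    rw [← ofReal_measureReal, bernoulliMeasure_real_apply _ (measurableSet_singleton _)]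
    simp [p]
  have hfalse : (bernoulliMeasure true false p) {false} = ENNReal.ofReal (1 - c) := by
    rw [← ofReal_measureReal, bernoulliMeasure_real_apply _ (measurableSet_singleton _)]
    simp [p]
  refine ⟨bernoulliMeasure true false p, inferInstance, N, ?_⟩
  rw [htrue, hfalse, ← ENNReal.ofReal_pow (by linarith),
    ← ENNReal.ofReal_add (pow_nonneg (by linarith) N) hc0.le]
  exact ENNReal.ofReal_le_ofReal (by linarith)

section Intertwining

variable {W : Type*} [MeasurableSpace W] {Q : Measure W} [IsProbabilityMeasure Q]
  {X : Type*} [MeasurableSpace X] {μ : Measure X} {T : mpGroup μ} {φ : (ℤ → W) → X}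

theorem exists_mpGroup_apply_eq_shiftBy [StandardBorelSpace X] [IsProbabilityMeasure μ]
    [NullSingletonClass μ] {ψ : X → ℤ → W} (h : AEIso (iidMeasure Q) μ φ ψ) :
    ∃ T : mpGroup μ, ∀ᵐ y ∂iidMeasure Q, (T : Equiv.Perm X) (φ y) = φ (shiftBy 1 y) := by
  have := uncountable_of_nullSingletonClass μ
  obtain ⟨T, hT⟩ := ((h.symm.trans (aeIso_shiftBy Q 1)).trans h).exists_mpGroup
  refine ⟨T, ?_⟩
  filter_upwards [h.mp.quasiMeasurePreserving.ae hT, h.left_inv] with y hy hinv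
  rw [hy, hinv]

theorem zpow_apply_ae_eq_shiftBy
    (hT : ∀ᵐ y ∂iidMeasure Q, (T : Equiv.Perm X) (φ y) = φ (shiftBy 1 y)) (k : ℤ) :
    ∀ᵐ y ∂iidMeasure Q, ((T ^ k : mpGroup μ) : Equiv.Perm X) (φ y) = φ (shiftBy k y) := by
  have hshift := fun l => (measurePreserving_shiftBy Q l).quasiMeasurePreserving
  induction k with
  | zero => exact Eventually.of_forall fun y => by simp [shiftBy_zero]
  | succ k ih =>
    filter_upwards [ih, (hshift k).ae hT] with y hy hstep
    rw [add_comm (k : ℤ), zpow_one_add, ← shiftBy_shiftBy, ← hstep, ← hy]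
    rfl
  | pred k ih =>
    filter_upwards [ih, (hshift (-k - 1)).ae hT] with y hy hstep
    rw [shiftBy_shiftBy, add_sub_cancel] at hstep
    rw [sub_eq_neg_add, zpow_add, zpow_neg_one, neg_add_eq_sub, ← Equiv.symm_apply_apply
      (T : Equiv.Perm X) (φ (shiftBy (-k - 1) y)), hstep, ← hy]
    rfl

end Intertwining

variable {X : Type*} [MeasurableSpace X] {μ : Measure X} [IsProbabilityMeasure μ]

section Resampling

variable (κ : Measure Bool) [IsProbabilityMeasure κ] {T T₀ : mpGroup μ} {N : ℕ}
  {φ : (ℤ → Bool × X) → X}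

theorem measure_symmDiff_preimage_le_of_resample [StandardBorelSpace X]
    (hφ : MeasurePreserving φ (iidMeasure (κ.prod μ)) μ)
    (hT : ∀ᵐ y ∂iidMeasure (κ.prod μ), (T : Equiv.Perm X) (φ y) = φ (shiftBy 1 y))
    {B : Set X} (hB : MeasurableSet B)
    (hφB : ∀ᵐ y ∂iidMeasure (κ.prod μ),
      φ y ∈ B ↔ resample (T₀ : Equiv.Perm X) N y ∈ B)
    (hφB' : ∀ᵐ y ∂iidMeasure (κ.prod μ), φ y ∈ (T₀ : Equiv.Perm X) ⁻¹' B ↔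
      resample (T₀ : Equiv.Perm X) N y ∈ (T₀ : Equiv.Perm X) ⁻¹' B) :
    μ (((T : Equiv.Perm X) ⁻¹' B) ∆ ((T₀ : Equiv.Perm X) ⁻¹' B)) ≤ κ {false} ^ N + κ {true} := by
  have hm : MeasurableSet (((T : Equiv.Perm X) ⁻¹' B) ∆ ((T₀ : Equiv.Perm X) ⁻¹' B)) :=
    ((mpGroup_mp T).measurable hB).symmDiff ((mpGroup_mp T₀).measurable hB)
  rw [← hφ.measure_preimage hm.nullMeasurableSet]
  refine (measure_mono_ae ?_).trans
    (measure_resample_shiftBy_ne_le κ (μ := μ) (mpGroup_mp T₀).measurable N)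
  have hshift := (measurePreserving_shiftBy (κ.prod μ) 1).quasiMeasurePreserving
  filter_upwards [hT, hshift.ae hφB, hφB'] with y hy hyB hyB' hmem heq
  have hiff : φ y ∈ (T : Equiv.Perm X) ⁻¹' B ↔ φ y ∈ (T₀ : Equiv.Perm X) ⁻¹' B := by
    rw [hyB', mem_preimage, mem_preimage, hy, hyB, heq]
  exact notMem_symmDiff_iff.2 hiff hmem

theorem mul_partEntropy_le_joinEntropy_of_resample
    (hφ : MeasurePreserving φ (iidMeasure (κ.prod μ)) μ)
    (hT : ∀ᵐ y ∂iidMeasure (κ.prod μ), (T : Equiv.Perm X) (φ y) = φ (shiftBy 1 y))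
    {n : ℕ} {f : X → Fin n} (hf : Measurable f)
    (hφf : ∀ᵐ y ∂iidMeasure (κ.prod μ), f (φ y) = f (resample (T₀ : Equiv.Perm X) N y))
    {j : ℕ} (hj : N < j) (L : ℕ) :
    L * partEntropy μ f ≤ joinEntropy (T : Aut μ) (progression j L) f := by
  refine (mul_partEntropy_le_famEntropy_resample κ (mpGroup_mp T₀) hf hj L).trans_eq ?_
  have hm : Measurable (joinLabel T (progression j L) f) :=
    measurable_restrict_fam (measurable_zpow_comp T hf) _
  refine Eq.trans ?_ (partEntropy_comp_measurePreserving hφ hm)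
  refine partEntropy_congr ?_
  have hlabel : ∀ p : progression j L, ∀ᵐ y ∂iidMeasure (κ.prod μ),
      f (resample (T₀ : Equiv.Perm X) N (shiftBy (-(p : ℤ)) y)) =
        f (((T ^ (-(p : ℤ)) : mpGroup μ) : Equiv.Perm X) (φ y)) := fun p => by
    filter_upwards [zpow_apply_ae_eq_shiftBy hT (-(p : ℤ)),
      (measurePreserving_shiftBy (κ.prod μ) (-(p : ℤ))).quasiMeasurePreserving.ae hφf] with y hy hyf
    rw [hy, hyf]
  filter_upwards [ae_all_iff.2 hlabel] with y hy
  exact funext hy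

end Resampling

variable [StandardBorelSpace X] [NullSingletonClass μ]

theorem exists_aeIso_forall_mem_iff {Y : Type*} [MeasurableSpace Y] [StandardBorelSpace Y]
    {ν : Measure Y} [IsProbabilityMeasure ν] [NullSingletonClass ν] {Z : Y → X}
    (hZ : MeasurePreserving Z ν μ) {𝓓 : Set (Set X)} (h𝓓 : 𝓓.Finite)
    (hD : ∀ D ∈ 𝓓, MeasurableSet D) :
    ∃ (φ : Y → X) (ψ : X → Y), AEIso ν μ φ ψ ∧ ∀ᵐ y ∂ν, ∀ D ∈ 𝓓, φ y ∈ D ↔ Z y ∈ D := by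
  have := h𝓓.to_subtype
  obtain ⟨e, he⟩ := exists_injective_nat (𝓓 → Prop)
  let q : X → ℕ := fun x => e fun D => x ∈ D.1
  have hq : Measurable q := (measurable_of_countable e).comp
    (measurable_pi_lambda _ fun D => measurableSet_setOfPred.1 (hD D D.2))
  obtain ⟨φ, ψ, h, hφ⟩ := exists_aeIso_of_measure_preimage_eq (P := ν) (P' := μ)
    (hq.comp hZ.measurable) hq fun s =>
      hZ.measure_preimage (hq (MeasurableSet.of_discrete (s := s))).nullMeasurableSet
  refine ⟨φ, ψ, h, ?_⟩
  filter_upwards [hφ] with y hy D hD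
  exact Iff.of_eq (congrFun (he hy) ⟨D, hD⟩)

theorem exists_approx_independent (T₀ : mpGroup μ) {δ : ℝ} (hδ : 0 < δ) {𝓓 : Set (Set X)}
    (h𝓓 : 𝓓.Finite) (hD : ∀ D ∈ 𝓓, MeasurableSet D) :
    ∃ T : mpGroup μ,
      (∀ D ∈ 𝓓, μ.real (((T : Equiv.Perm X) ⁻¹' D) ∆ ((T₀ : Equiv.Perm X) ⁻¹' D)) ≤ δ) ∧
      ∃ N : ℕ, ∀ j, N < j → ∀ (L : ℕ), ∀ D ∈ 𝓓, L * Real.binEntropy (μ.real D) ≤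
        joinEntropy (T : Aut μ) (progression j L) (indicatorLabel D) := by
  obtain ⟨κ, hκ, N, hN⟩ := exists_coin hδ
  have := nullSingletonClass_iidMeasure (κ.prod μ)
  obtain ⟨φ, ψ, hφ, hφD⟩ := exists_aeIso_forall_mem_iff
    (measurePreserving_resample κ (mpGroup_mp T₀) N)
    (h𝓓.union (h𝓓.image fun D => (T₀ : Equiv.Perm X) ⁻¹' D)) (by
      rintro _ (hD' | ⟨D, hD', rfl⟩)
      · exact hD _ hD'
      · exact (mpGroup_mp T₀).measurable (hD D hD'))
  obtain ⟨T, hT⟩ := exists_mpGroup_apply_eq_shiftBy hφ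
  have hmem : ∀ D ∈ 𝓓, ∀ᵐ y ∂iidMeasure (κ.prod μ),
      φ y ∈ D ↔ resample (T₀ : Equiv.Perm X) N y ∈ D := fun D hD' =>
    hφD.mono fun y hy => hy D (Or.inl hD')
  refine ⟨T, fun D hD' => ENNReal.toReal_le_of_le_ofReal hδ.le ?_, N, fun j hj L D hD' => ?_⟩
  · exact (measure_symmDiff_preimage_le_of_resample κ hφ.mp hT (hD D hD') (hmem D hD')
      (hφD.mono fun y hy => hy _ (Or.inr (mem_image_of_mem _ hD')))).trans hN
  · rw [← partEntropy_indicatorLabel (hD D hD')]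
    refine mul_partEntropy_le_joinEntropy_of_resample κ (T₀ := T₀) hφ.mp hT
      (measurable_indicatorLabel (hD D hD')) ?_ hj L
    filter_upwards [hmem D hD'] with y hy
    classical simp only [indicatorLabel, hy]

theorem exists_halmosDist_lt_independent (A : ℕ → MeasuredSets μ) (T₀ : Aut μ) {B : Set X}
    (hB : MeasurableSet B) {ε : ℝ} (hε : 0 < ε) :
    ∃ T : Aut μ, halmosDist A T T₀ < ε ∧ ∃ N : ℕ, ∀ j, N < j → ∀ L : ℕ,
      L * Real.binEntropy (μ.real B) ≤ joinEntropy T (progression j L) (indicatorLabel B) := by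
  induction T₀ using QuotientGroup.induction_on with | H T₀ => ?_
  let 𝓓 : ℕ → Set (Set X) := fun M => insert B
    ((fun i => (A i : Set X)) '' Iio M ∪ (fun i => (T₀ : Equiv.Perm X) '' (A i : Set X)) '' Iio M)
  have h𝓓 : ∀ M, (𝓓 M).Finite := fun M =>
    (((finite_Iio M).image _).union ((finite_Iio M).image _)).insert B
  have hm : ∀ M, ∀ D ∈ 𝓓 M, MeasurableSet D := by
    rintro M _ (rfl | ⟨i, _, rfl⟩ | ⟨i, _, rfl⟩)
    · exact hB
    · exact measurableSet_coe (A i)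
    · exact measurableSet_image T₀ (measurableSet_coe (A i))
  choose T hT N hN using fun M : ℕ =>
    exists_approx_independent T₀ (Nat.one_div_pos_of_nat (α := ℝ) (n := M)) (h𝓓 M) (hm M)
  have hsmall : ∀ D, (∀ᶠ M in atTop, D ∈ 𝓓 M) →
      Tendsto (fun M => moveDist D (T M : Aut μ)⁻¹ (T₀ : Aut μ)⁻¹) atTop (𝓝 0) := fun D hD =>
    squeeze_zero' (Eventually.of_forall fun M => moveDist_nonneg _ _ _)
      (hD.mono fun M hM => (moveDist_inv_mk D (T M) T₀).trans_le (hT M D hM))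
      tendsto_one_div_add_atTop_nhds_zero_nat
  have hlim : Tendsto (fun M => halmosDist A (T M : Aut μ) (T₀ : Aut μ)) atTop (𝓝 0) := by
    refine tendsto_halmosDist A (fun i => ?_) fun i => hsmall _ ?_
    · simp only [moveDist_eq_moveDist_inv_image (measurableSet_coe (A i)) _ T₀]
      exact hsmall _ <| (eventually_gt_atTop i).mono fun M hM =>
        Or.inr (Or.inr (mem_image_of_mem _ hM))
    · exact (eventually_gt_atTop i).mono fun M hM => Or.inr (Or.inl (mem_image_of_mem _ hM))
  obtain ⟨M, hM⟩ := (hlim.eventually_lt_const hε).exists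
  exact ⟨T M, hM, N M, fun j hj L => hN M j hj L B (mem_insert B _)⟩

theorem exists_measureReal_eq_half (μ : Measure X) [IsProbabilityMeasure μ]
    [NullSingletonClass μ] : ∃ B : Set X, MeasurableSet B ∧ μ.real B = 2⁻¹ := by
  obtain ⟨g, f, h, _⟩ := exists_aeIso_unit (P := μ) (q := fun _ => 0) measurable_const
  refine ⟨f ⁻¹' Iio 2⁻¹, h.mp_inv.measurable measurableSet_Iio, ?_⟩
  rw [h.mp_inv.measureReal_preimage measurableSet_Iio.nullMeasurableSet,
    measureReal_restrict_apply measurableSet_Iio, inter_comm, Ioo_inter_Iio,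
    min_eq_right (by norm_num), Real.volume_real_Ioo_of_le (by norm_num), sub_zero]

end Density

section Category

variable {X : Type*} [MeasurableSpace X] {μ : Measure X} [IsProbabilityMeasure μ]
  {A : ℕ → MeasuredSets μ} {K : Set (Aut μ)} {L : ℕ → ℕ} {B : Set X}

theorem eventually_joinEntropy_conj_le (hA : DenseRange A)
    (hL : ∀ j, ∀ i ≤ j, ∀ S ∈ K,
      joinEntropy S (progression (j + 1) (L j)) (indicatorLabel (A i : Set X)) <
        1 / ((j : ℝ) + 1) * L j)
    {T : Aut μ} (hT : T ∈ conjugates K) (hB : MeasurableSet B) {c : ℝ} (hc : 0 < c) :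
    ∀ᶠ j in atTop, joinEntropy T (progression (j + 1) (L j)) (indicatorLabel B) ≤ L j * c := by
  obtain ⟨S, hS, J, rfl⟩ := hT
  obtain ⟨J, rfl⟩ := QuotientGroup.mk_surjective J
  have hJB := measurableSet_image J hB
  obtain ⟨i, hi⟩ : ∃ i, Real.binEntropy (μ.real (((J : Equiv.Perm X) '' B) ∆ (A i : Set X))) <
      c / 2 := by
    have hbin : ∀ᶠ d in 𝓝 (0 : ℝ), Real.binEntropy d < c / 2 :=
      Real.binEntropy_continuous.continuousAt.eventually_lt_const
        (Real.binEntropy_zero.trans_lt (half_pos hc))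
    obtain ⟨η, hη, hbin⟩ := Metric.eventually_nhds_iff.1 hbin
    obtain ⟨i, hi⟩ := Metric.denseRange_iff.1 hA ⟨_, hJB⟩ η hη
    refine ⟨i, hbin ?_⟩
    rwa [Real.dist_0_eq_abs, abs_of_nonneg measureReal_nonneg]
  filter_upwards [eventually_ge_atTop i,
    (tendsto_one_div_add_atTop_nhds_zero_nat (𝕜 := ℝ)).eventually_lt_const (half_pos hc)]
    with j hij hj
  calc joinEntropy ((J : Aut μ)⁻¹ * S * (J : Aut μ)) (progression (j + 1) (L j)) (indicatorLabel B)
      ≤ joinEntropy S (progression (j + 1) (L j)) (indicatorLabel (A i : Set X)) +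
          (progression (j + 1) (L j)).card *
            Real.binEntropy (μ.real (((J : Equiv.Perm X) '' B) ∆ (A i : Set X))) := by
        rw [joinEntropy_conj_indicatorLabel J S _ hB]
        exact joinEntropy_indicatorLabel_le S _ hJB (measurableSet_coe (A i))
    _ ≤ c / 2 * L j + L j * (c / 2) := by
        gcongr
        · exact (hL j i hij S hS).le.trans (by gcongr)
        · exact Real.binEntropy_nonneg measureReal_nonneg measureReal_le_one
        · exact card_progression_le _ _
    _ = L j * c := by ring

variable [StandardBorelSpace X]

theorem exists_progression_length (hA : DenseRange A) (hKE : K ⊆ zeroEntropy μ)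
    (hK : letI := halmosMetric A hA; IsCompact K) (j : ℕ) :
    ∃ L : ℕ, 0 < L ∧ ∀ i ≤ j, ∀ S ∈ K,
      joinEntropy S (progression (j + 1) L) (indicatorLabel (A i : Set X)) <
        1 / ((j : ℝ) + 1) * L := by
  choose L hL h using fun i => exists_uniform_joinEntropy_lt hA hKE hK
    (measurable_indicatorLabel (measurableSet_coe (A i))) j.succ_pos
    (by positivity : (0 : ℝ) < 1 / ((j : ℝ) + 1))
  have hpos : 0 < ∏ i ∈ Finset.range (j + 1), L i := Finset.prod_pos fun i _ => hL i
  refine ⟨∏ i ∈ Finset.range (j + 1), L i, hpos, fun i hi S hS => ?_⟩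
  obtain ⟨m, hm⟩ := Finset.dvd_prod_of_mem L (Finset.mem_range.2 (Nat.lt_succ_of_le hi))
  rw [hm, mul_comm (L i)] at hpos ⊢
  exact h i m (Nat.pos_of_mul_pos_right hpos) S hS

variable [NullSingletonClass μ]

theorem residual_frequently_lt_joinEntropy (hA : DenseRange A) (hL : ∀ j, 0 < L j)
    (hB : MeasurableSet B) {c : ℝ} (hc : c < Real.binEntropy (μ.real B)) :
    letI := halmosMetric A hA
    ∀ᶠ T in residual (Aut μ), ∃ᶠ j in atTop,
      L j * c < joinEntropy T (progression (j + 1) (L j)) (indicatorLabel B) := by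
  let _ := halmosMetric A hA
  simp only [frequently_atTop]
  refine eventually_countable_forall.2 fun m => ?_
  let U : ℕ → Set (Aut μ) := fun j =>
    {T | L j * c < joinEntropy T (progression (j + 1) (L j)) (indicatorLabel B)}
  have hopen : IsOpen (⋃ j ≥ m, U j) := isOpen_biUnion fun j _ => isOpen_lt continuous_const
    (continuous_joinEntropy hA (fun _ => nonneg_of_mem_progression) (measurable_indicatorLabel hB))
  have hdense : Dense (⋃ j ≥ m, U j) := by
    refine Metric.dense_iff.2 fun T₀ ε hε => ?_
    obtain ⟨T, hT, N, hN⟩ := exists_halmosDist_lt_independent A T₀ hB hε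
    refine ⟨T, hT, mem_iUnion₂.2 ⟨max m N, le_max_left m N, lt_of_lt_of_le ?_
      (hN (max m N + 1) (Nat.lt_succ_of_le (le_max_right m N)) (L (max m N)))⟩⟩
    exact mul_lt_mul_of_pos_left hc (mod_cast hL _)
  filter_upwards [residual_of_dense_open hopen hdense] with T hT
  simpa only [U, mem_iUnion, exists_prop, mem_ofPred_eq] using hT

theorem isMeagre_conjugates (hA : DenseRange A) (hKE : K ⊆ zeroEntropy μ)
    (hK : letI := halmosMetric A hA; IsCompact K) :
    letI := halmosMetric A hA; IsMeagre (conjugates K) := by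
  let _ := halmosMetric A hA
  choose L hL0 hL using exists_progression_length hA hKE hK
  obtain ⟨B, hB, hBhalf⟩ := exists_measureReal_eq_half μ
  have hlog : 0 < Real.log 2 := Real.log_pos one_lt_two
  have hc : Real.log 2 / 2 < Real.binEntropy (μ.real B) := by
    rw [hBhalf, Real.binEntropy_two_inv]
    exact half_lt_self hlog
  filter_upwards [residual_frequently_lt_joinEntropy hA hL0 hB hc] with T hfreq hT
  exact hfreq <| (eventually_joinEntropy_conj_le hA hL hT hB (half_pos hlog)).mono
    fun _ => not_lt.2

end Category

end ErgodicAut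

theorem theorem7p2 {X : Type*} [MeasurableSpace X] [StandardBorelSpace X]
    (μ : MeasureTheory.Measure X) [MeasureTheory.IsProbabilityMeasure μ]
    [MeasureTheory.NullSingletonClass μ]
    (A : ℕ → MeasureTheory.MeasuredSets μ) (hA : DenseRange A)
    (K : Set (ErgodicAut.Aut μ)) (hKE : K ⊆ ErgodicAut.zeroEntropy μ)
    (hK : letI := ErgodicAut.halmosMetric A hA; IsCompact K) :
    letI := ErgodicAut.halmosMetric A hA
    IsMeagre (ErgodicAut.conjugates K) ∧ ¬ ErgodicAut.IsTypical (ErgodicAut.conjugates K) := by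
  let _ := ErgodicAut.halmosMetric A hA
  have : CompleteSpace (ErgodicAut.Aut μ) := ErgodicAut.completeSpace_halmosMetric hA
  have hmeagre : IsMeagre (ErgodicAut.conjugates K) := ErgodicAut.isMeagre_conjugates hA hKE hK
  exact ⟨hmeagre, not_isMeagre_of_mem_residual hmeagre⟩
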